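/- Let $\mathbb K$ be a field of characteristic $0$ and let $q\in\mathbb K$ be transcendental over $\mathbb Q$. Grade $R=\mathbb K[x]$ by $\mathbb Z$ with $\deg x=1$ and let $\beta(n,m)=q^{nm}$ on $\mathbb Z\times\mathbb Z$. Let $D=D_q(\mathbb K[x])$ be the algebra of quantum differential operators of Lunts and Rosenberg: regard $\mathrm{End}_{\mathbb K}(R)$ as an $R$-bimodule by $(r\varphi s)(t)=r\varphi(st)$, put $[\varphi,r]_a=\varphi r-\beta(a,\deg r)\,r\varphi$ for $a\in\mathbb Z$ and $r\in R$ homogeneous, let $D^{-1}=0$, for $i\ge 0$ let $D^{i}$ be the $R$-bimodule generated by the homogeneous $\varphi\in\mathrm{End}_{\mathbb K}(R)$ for which there is $a\in\mathbb Z$ with $[\varphi,r]_a\in D^{i-1}$ for all homogeneous $r\in R$, and let $D=\bigcup_{i\ge0}D^{i}$. For $a\in\{-1,0,1\}$ let $\partial_a$ be the operator on $\mathbb K[x]$ with $\partial_a(x^n)=(1+q^a+\dots+q^{a(n-1)})x^{n-1}$ for $n\geq 1$ and $\partial_a(1)=0$, and write $\partial=\partial_0$; write $x$ also for multiplication by $x$.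 Let $G$ be the subalgebra of $D$ generated by $\partial,\partial_1,\partial_{-1}$, which is $\mathbb N$-graded with these generators in degree $1$ (that is, $G_n$ consists of the operators in $G$ that lower the degree in $x$ by $n$). Let $$\mathcal G=\{\partial_1^j\partial_{-1}^k\partial^\ell: j,k,\ell\ge 0\}\cup\{\partial_1^j\partial\partial_1^k\partial^\ell: j,\ell\ge0,\ k>0\},$$ $$\mathcal D=\mathcal G\cup\{x^j\partial_1^k\partial^\ell: j>0,\ k,\ell\ge0\}\cup\{x^j\partial_{-1}^k\partial^\ell: j>0,\ k,\ell\ge0\}.$$ **Theorem.** 1. For $n\ge1$, $\dim_{\mathbb K} G_n=n^2+n+1$, and $\mathcal G$ is a basis for $G$. The Hilbert series $\sum_{n\ge0}(\dim_{\mathbb K} G_n)t^n$ of $G$ is $(1+t^2)/(1-t)^{3}$, and the Gelfand–Kirillov dimension of $G$ is $3$. 2. $\mathcal D$ is a basis for $D$. (In both cases, monomials that are distinct as words in $x,\partial,\partial_1,\partial_{-1}$ are distinct operators.) -/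

import Mathlib

open Polynomial

noncomputable section

namespace QDiff

section General

/-! Quantum differential operators (in the sense of Lunts and Rosenberg) on a `Γ`-graded
`K`-algebra `R` with homogeneous components `𝒜 d`, for a bicharacter `β` on `Γ`. -/

variable {K R Γ : Type*} [Field K] [Ring R] [Algebra K R] [AddCommGroup Γ]

/-- The `K`-linear endomorphisms of `R` that are homogeneous of degree `d`. -/
def homogeneousEnd (𝒜 : Γ → Submodule K R) (d : Γ) : Submodule K (Module.End K R) where
  carrier := {φ | ∀ e : Γ, ∀ r ∈ 𝒜 e, φ r ∈ 𝒜 (d + e)}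
  zero_mem' := fun _ _ _ => Submodule.zero_mem _
  add_mem' := fun hφ hψ e r hr => Submodule.add_mem _ (hφ e r hr) (hψ e r hr)
  smul_mem' := fun c _ hφ e r hr => Submodule.smul_mem _ c (hφ e r hr)

/-- The sub-`R`-bimodule of `End_K(R)` generated by `S`, where `r φ s` is the operator
`t ↦ r * φ (s * t)`. -/
def bimoduleSpan (S : Set (Module.End K R)) : Submodule K (Module.End K R) :=
  Submodule.span K
    {ψ | ∃ φ ∈ S, ∃ r s : R, ψ = LinearMap.mulLeft K r * φ * LinearMap.mulLeft K s}

/-- The homogeneous operators `φ` for which there is `a ∈ Γ` such that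
`[φ, r]_a = φ r - β(a, deg r) r φ` lies in `N` for all homogeneous `r ∈ R`
(equivalently, `[φ, r]_a = φ r - σ_a(r) φ` lies in `N` for all `r ∈ R`). -/
def commutesModulo (𝒜 : Γ → Submodule K R) (β : Γ → Γ → K)
    (N : Submodule K (Module.End K R)) : Set (Module.End K R) :=
  {φ | (∃ d : Γ, φ ∈ homogeneousEnd 𝒜 d) ∧
    ∃ a : Γ, ∀ e : Γ, ∀ r ∈ 𝒜 e,
      φ * LinearMap.mulLeft K r - β a e • (LinearMap.mulLeft K r * φ) ∈ N}

/-- The bimodule `D_q^i(R)` of quantum differential operators of order at most `i`. -/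
def quantumDiffOrder (𝒜 : Γ → Submodule K R) (β : Γ → Γ → K) :
    ℕ → Submodule K (Module.End K R)
  | 0 => bimoduleSpan (commutesModulo 𝒜 β ⊥)
  | i + 1 => bimoduleSpan (commutesModulo 𝒜 β (quantumDiffOrder 𝒜 β i))

/-- `D_q(R)`, the union of the increasing sequence `D_q^i(R)`. -/
def quantumDiff (𝒜 : Γ → Submodule K R) (β : Γ → Γ → K) : Submodule K (Module.End K R) :=
  ⨆ i : ℕ, quantumDiffOrder 𝒜 β i

end General

/-- The Gelfand–Kirillov dimension of a `K`-algebra: the supremum over the finite-dimensional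
subspaces `V` of `limsup_n log (dim (K + V + V² + ⋯ + Vⁿ)) / log n`. Note that
`(K + V)ⁿ = K + V + ⋯ + Vⁿ`. -/
def gkDim (K A : Type*) [Field K] [Ring A] [Algebra K A] : EReal :=
  ⨆ V : {V : Submodule K A // V.FG},
    Filter.limsup (fun n : ℕ =>
      ((Real.log (Module.finrank K ↥((1 ⊔ (V : Submodule K A)) ^ n)) / Real.log n : ℝ) : EReal))
      Filter.atTop

section Poly

variable {K : Type*} [Field K]

/-- The `ℤ`-grading of `K[x]` with `deg x = 1`. -/
def polyGrading (K : Type*) [Field K] (d : ℤ) : Submodule K K[X] :=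
  Submodule.span K {p | ∃ n : ℕ, (n : ℤ) = d ∧ p = X ^ n}

/-- The bicharacter `β(n, m) = q^(nm)` on `ℤ`. -/
def bichar (q : K) (n m : ℤ) : K := q ^ (n * m)

/-- `D = D_q(K[x])`. -/
def DqPoly (q : K) : Submodule K (Module.End K K[X]) :=
  quantumDiff (polyGrading K) (bichar q)

/-- The `q`-number `1 + m + ⋯ + m^(n-1)`. -/
def qNum (n : ℕ) (m : K) : K := ∑ i ∈ Finset.range n, m ^ i

/-- The operator `x ^ n ↦ [n]_{q^a} x ^ (n-1)` on `K[x]` (so `1 ↦ 0`). -/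
def del (q : K) (a : ℤ) : Module.End K K[X] :=
  (basisMonomials K).constr K fun n : ℕ => qNum n (q ^ a) • (X : K[X]) ^ (n - 1)

/-- The subalgebra generated by `∂`, `∂₁` and `∂₋₁`. -/
def G (q : K) : Subalgebra K (Module.End K K[X]) :=
  Algebra.adjoin K {del q 0, del q 1, del q (-1)}

/-- The degree `n` component of `G`, in which `∂`, `∂₁`, `∂₋₁` have degree `1`: the operators in `G`
that lower the degree in `x` by `n`. -/
def Gcomp (q : K) (n : ℕ) : Submodule K (Module.End K K[X]) :=
  Subalgebra.toSubmodule (G q) ⊓ homogeneousEnd (polyGrading K) (-(n : ℤ))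

/-- The four generators `x`, `∂`, `∂₁`, `∂₋₁`, as formal letters. -/
inductive Letter
  | x
  | d
  | d₁
  | dₘ₁

/-- The operator on `K[x]` denoted by a letter. -/
def letterOp (q : K) : Letter → Module.End K K[X]
  | .x => LinearMap.mulLeft K X
  | .d => del q 0
  | .d₁ => del q 1
  | .dₘ₁ => del q (-1)

/-- The operator on `K[x]` denoted by a monomial (a word in the letters). -/
def evalMon (q : K) : FreeMonoid Letter →* Module.End K K[X] :=
  FreeMonoid.lift (letterOp q)

end Poly

/-! The formal monomials `x`, `∂`, `∂₁`, `∂₋₁` of length one. -/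

def xw : FreeMonoid Letter := FreeMonoid.of Letter.x

def dw : FreeMonoid Letter := FreeMonoid.of Letter.d

def d₁w : FreeMonoid Letter := FreeMonoid.of Letter.d₁

def dₘ₁w : FreeMonoid Letter := FreeMonoid.of Letter.dₘ₁

/-- The set of monomials `𝒢`: the standard monomials `∂₁ʲ ∂₋₁ᵏ ∂ˡ` and the non-standard special
monomials `∂₁ʲ ∂ ∂₁ᵏ ∂ˡ`, `k > 0`. -/
def monG : Set (FreeMonoid Letter) :=
  {w | ∃ j k l : ℕ, w = d₁w ^ j * dₘ₁w ^ k * dw ^ l} ∪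
  {w | ∃ j k l : ℕ, 0 < k ∧ w = d₁w ^ j * dw * d₁w ^ k * dw ^ l}

/-- The set of monomials `𝒟`: those of `𝒢`, and the monomials `xʲ ∂₁ᵏ ∂ˡ` and `xʲ ∂₋₁ᵏ ∂ˡ` with
`j > 0`. -/
def monD : Set (FreeMonoid Letter) :=
  monG ∪
  {w | ∃ j k l : ℕ, 0 < j ∧ w = xw ^ j * d₁w ^ k * dw ^ l} ∪
  {w | ∃ j k l : ℕ, 0 < j ∧ w = xw ^ j * dₘ₁w ^ k * dw ^ l}

end QDiff

end

/-! An operator on $K[x]$ is determined by its homogeneous components. The component of degree $-m$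
is a sequence $f$, via $x^n \mapsto f(n)x^{n-m}$, with $f(n)=0$ for $n<m$. Composition with $x$
becomes the shift $S$ on sequences, and both halves of the theorem become statements about
exponential polynomials, the combinations of $n^pq^{kn}$. Of the transcendence of $q$, only the
injectivity of $k\mapsto q^k$ on the integers is needed.

Description of $D$. The bracket $[\varphi,x]_a$ acts on sequences as $S-q^a$. This operator maps the
exponential polynomials onto themselves and has kernel spanned by $q^{an}$, so by induction on the
order all components of elements of $D$ are exponential polynomials (`DqPoly_le_finiteComps`).
Conversely, exponential polynomials are killed by products of factors $S-q^a$, and a sequence killed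
by such a product gives an element of $D$ (`mem_DqPoly_of_annihilated`).

Bound for $G$. Each generator multiplies the sequence of an operator of degree $-m$ by a multiple of
$n-m$, $q^n-q^m$ or $(q^n-q^m)q^{-n}$. Hence the degree $-m$ part of $G$ consists of combinations of
$n^pq^{kn}$ with $p+|k|\le m$ that vanish at $n=0,\dots,m-1$.

Counting. There are $(N+1)^2$ pairs with $p+|k|\le N$. If $m\le N$, vanishing at the first
$\max(m,0)$ integers costs that many dimensions. The monomials of degree $-m$ are labelled by the
pairs $(p,k)$ other than $(0,k)$ with $0\le k<m$, so for each $N\ge m$ exactly the right number of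
labels lies in the ball. Linear independence (`linearIndependent_evalMon_word`) therefore forces
spanning (`indexSpan_eq_map`). Taking $N=m$ gives $G$, with dimension $(m+1)^2-m$, and letting $N$
grow gives $D$.

Independence. The sequence of a monomial is a polynomial in $n$ over the Laurent polynomials in
$T=q^n$. The coefficient of the top power $n^p$ is a multiple of $T^{-r}\prod_{j\in J}(T-q^j)$. Most
labels are detected by the coefficient of $T^k$ in it. The labels with $k\ge0$, $p>0$, $p+k\le m$
all give the same degree in $T$, but they form a Lagrange-type basis and are detected by evaluation
at $T=q^{p-1+k}$. -/

noncomputable section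

namespace QDiff

/-! ### Homogeneous components of operators as sequences -/

section Components

variable {K : Type*} [Field K]

/-- The coefficient of a polynomial at an integer exponent. -/
def coeffInt (z : ℤ) : K[X] →ₗ[K] K := if 0 ≤ z then lcoeff K z.toNat else 0

theorem coeffInt_natCast (n : ℕ) (p : K[X]) : coeffInt (n : ℤ) p = p.coeff n := by
  simp [coeffInt]

theorem coeffInt_of_neg {z : ℤ} (hz : z < 0) (p : K[X]) : coeffInt z p = 0 := by
  simp [coeffInt, not_le.mpr hz]

theorem coeffInt_X_pow (z : ℤ) (k : ℕ) :
    coeffInt z (X ^ k : K[X]) = if z = k then 1 else 0 := by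
  rcases lt_or_ge z 0 with hz | hz
  · rw [coeffInt_of_neg hz, if_neg (by omega)]
  · lift z to ℕ using hz
    simp [coeffInt_natCast, coeff_X_pow]

theorem coeffInt_X_mul (z : ℤ) (p : K[X]) : coeffInt z (X * p) = coeffInt (z - 1) p := by
  rcases lt_trichotomy z 0 with hz | rfl | hz
  · rw [coeffInt_of_neg hz, coeffInt_of_neg (by omega)]
  · rw [coeffInt_of_neg (by omega : (0 : ℤ) - 1 < 0)]
    exact (coeffInt_natCast 0 (X * p)).trans (by simp)
  · obtain ⟨k, rfl⟩ : ∃ k : ℕ, z = ((k + 1 : ℕ) : ℤ) := ⟨(z - 1).toNat, by omega⟩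
    rw [coeffInt_natCast, coeff_X_mul]
    simp [coeffInt_natCast]

theorem coeffInt_ext {p r : K[X]} (h : ∀ z, coeffInt z p = coeffInt z r) : p = r := by
  ext n
  simpa only [coeffInt_natCast] using h n

/-- The coefficient function of the component of degree `-m` of an operator on `K[x]`: it sends
`n` to the coefficient of `x ^ (n - m)` in the image of `x ^ n`. -/
def comp (m : ℤ) : Module.End K K[X] →ₗ[K] (ℕ → K) :=
  LinearMap.pi fun n => coeffInt (n - m) ∘ₗ LinearMap.applyₗ (X ^ n : K[X])

theorem comp_apply (m : ℤ) (φ : Module.End K K[X]) (n : ℕ) :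
    comp m φ n = coeffInt (n - m) (φ (X ^ n)) := rfl

theorem comp_of_lt {m : ℤ} (φ : Module.End K K[X]) {n : ℕ} (h : (n : ℤ) < m) :
    comp m φ n = 0 := coeffInt_of_neg (by omega) _

theorem comp_ext {φ ψ : Module.End K K[X]} (h : ∀ m, comp m φ = comp m ψ) : φ = ψ := by
  refine (basisMonomials K).ext fun n => coeffInt_ext fun z => ?_
  have := congrFun (h (n - z)) n
  simpa [comp_apply, X_pow_eq_monomial] using this

/-- The operator `x ^ n ↦ f(n) x ^ (n - m)`, where negative powers of `x` are read as `0`. -/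
def shiftOp (m : ℤ) : (ℕ → K) →ₗ[K] Module.End K K[X] where
  toFun f := (basisMonomials K).constr K fun n : ℕ =>
    if m ≤ n then f n • (X : K[X]) ^ (n - m).toNat else 0
  map_add' f g := by
    refine (basisMonomials K).ext fun n => ?_
    simp only [Module.Basis.constr_basis, LinearMap.add_apply]
    split_ifs <;> simp [add_smul]
  map_smul' c f := by
    refine (basisMonomials K).ext fun n => ?_
    simp only [Module.Basis.constr_basis, LinearMap.smul_apply, RingHom.id_apply]
    split_ifs <;> simp [mul_smul]

theorem shiftOp_apply (m : ℤ) (f : ℕ → K) (n : ℕ) :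
    shiftOp m f (X ^ n) = if m ≤ n then f n • (X : K[X]) ^ (n - m).toNat else 0 := by
  have := (basisMonomials K).constr_basis K (fun n : ℕ =>
    if m ≤ n then f n • (X : K[X]) ^ (n - m).toNat else 0) n
  simpa [shiftOp, X_pow_eq_monomial] using this

theorem comp_shiftOp_self (m : ℤ) (f : ℕ → K) (hf : ∀ n : ℕ, (n : ℤ) < m → f n = 0) :
    comp m (shiftOp m f) = f := by
  ext n
  rw [comp_apply, shiftOp_apply]
  split_ifs with h
  · simp [coeffInt_X_pow, h]
  · simp [hf n (by omega)]

theorem comp_shiftOp_of_ne {m m' : ℤ} (h : m' ≠ m) (f : ℕ → K) : comp m' (shiftOp m f) = 0 := by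
  ext n
  rw [comp_apply, shiftOp_apply]
  split_ifs with h'
  · rw [map_smul, coeffInt_X_pow, if_neg (by omega)]; simp
  · simp

theorem shiftOp_comp {m : ℤ} {φ : Module.End K K[X]} (h : ∀ m' ≠ m, comp m' φ = 0) :
    shiftOp m (comp m φ) = φ := by
  refine comp_ext fun m' => ?_
  by_cases hm : m' = m
  · subst hm
    exact comp_shiftOp_self _ _ fun n hn => comp_of_lt φ hn
  · rw [comp_shiftOp_of_ne hm, h m' hm]

theorem eq_sum_shiftOp_comp {φ : Module.End K K[X]} (s : Finset ℤ)
    (h : ∀ m ∉ s, comp m φ = 0) : φ = ∑ m ∈ s, shiftOp m (comp m φ) := by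
  refine comp_ext fun m' => ?_
  rw [map_sum]
  by_cases hm : m' ∈ s
  · rw [Finset.sum_eq_single_of_mem m' hm fun b _ hb => comp_shiftOp_of_ne hb.symm _]
    exact (comp_shiftOp_self _ _ fun n hn => comp_of_lt φ hn).symm
  · rw [h m' hm, Finset.sum_eq_zero]
    intro b hb
    exact comp_shiftOp_of_ne (by rintro rfl; exact hm hb) _

/-- The shift `f ↦ (n ↦ f(n + 1))` on sequences. -/
def seqShift (K : Type*) [Field K] : Module.End K (ℕ → K) := LinearMap.funLeft K K Nat.succ

theorem seqShift_apply (f : ℕ → K) (n : ℕ) : seqShift K f n = f (n + 1) := rfl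

theorem comp_X_mul (m : ℤ) (φ : Module.End K K[X]) :
    comp m (LinearMap.mulLeft K X * φ) = comp (m + 1) φ := by
  ext n
  simp only [comp_apply, Module.End.mul_apply, LinearMap.mulLeft_apply, coeffInt_X_mul]
  congr 2
  omega

theorem comp_mul_X (m : ℤ) (φ : Module.End K K[X]) :
    comp m (φ * LinearMap.mulLeft K X) = seqShift K (comp (m + 1) φ) := by
  ext n
  simp only [comp_apply, Module.End.mul_apply, LinearMap.mulLeft_apply, seqShift_apply,
    ← pow_succ']
  congr 2
  push_cast
  omega

theorem mulLeft_X_pow (e : ℕ) :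
    LinearMap.mulLeft K (X ^ e : K[X]) = LinearMap.mulLeft K X ^ e :=
  by
  simp

theorem comp_X_pow_mul (m : ℤ) (e : ℕ) (φ : Module.End K K[X]) :
    comp m (LinearMap.mulLeft K X ^ e * φ) = comp (m + e) φ := by
  induction e generalizing m with
  | zero => simp
  | succ e ih =>
    rw [pow_succ', mul_assoc, comp_X_mul, ih]
    congr 2
    push_cast
    ring

theorem comp_mul_X_pow (m : ℤ) (e : ℕ) (φ : Module.End K K[X]) :
    comp m (φ * LinearMap.mulLeft K X ^ e) = (seqShift K ^ e) (comp (m + e) φ) := by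
  induction e generalizing m with
  | zero => simp
  | succ e ih =>
    rw [pow_succ, ← mul_assoc, comp_mul_X, ih, pow_succ', Module.End.mul_apply]
    congr 4
    push_cast
    ring

theorem mem_polyGrading {d : ℤ} {p : K[X]} :
    p ∈ polyGrading K d ↔ ∀ z ≠ d, coeffInt z p = 0 := by
  constructor
  · intro hp z hz
    induction hp using Submodule.span_induction with
    | mem p hp =>
      obtain ⟨n, rfl, rfl⟩ := hp
      rw [coeffInt_X_pow, if_neg hz]
    | zero => simp
    | add p r _ _ hp hr => rw [map_add, hp, hr, add_zero]
    | smul c p _ hp => rw [map_smul, hp, smul_zero]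
  · intro h
    rcases lt_or_ge d 0 with hd | hd
    · have : p = 0 := by
        ext n
        simpa [coeffInt_natCast] using h n (by omega)
      rw [this]
      exact Submodule.zero_mem _
    · lift d to ℕ using hd
      have : p = p.coeff d • X ^ d := by
        ext n
        by_cases hn : n = d
        · simp [hn]
        · have := h n (by exact_mod_cast hn)
          rw [coeffInt_natCast] at this
          simp [this, coeff_X_pow, hn]
      rw [this]
      exact Submodule.smul_mem _ _ (Submodule.subset_span ⟨d, rfl, rfl⟩)

theorem mem_homogeneousEnd {d : ℤ} {φ : Module.End K K[X]} :
    φ ∈ homogeneousEnd (polyGrading K) d ↔ ∀ m ≠ -d, comp m φ = 0 := by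
  constructor
  · intro h m hm
    ext n
    rw [comp_apply]
    exact mem_polyGrading.mp (h n (X ^ n) (Submodule.subset_span ⟨n, rfl, rfl⟩)) _ (by omega)
  · intro h e r hr
    induction hr using Submodule.span_induction with
    | mem p hp =>
      obtain ⟨n, rfl, rfl⟩ := hp
      refine mem_polyGrading.mpr fun z hz => ?_
      have := congrFun (h (n - z) (by omega)) n
      simpa [comp_apply] using this
    | zero => simp
    | add p r _ _ hp hr => rw [map_add]; exact Submodule.add_mem _ hp hr
    | smul c p _ hp => rw [map_smul]; exact Submodule.smul_mem _ _ hp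

/-- The operators with finitely many nonzero components, the coefficient function of the component
of degree `-m` being in `S m`. -/
def finiteComps (S : ℤ → Submodule K (ℕ → K)) : Submodule K (Module.End K K[X]) where
  carrier := {φ | (∀ m, comp m φ ∈ S m) ∧ {m | comp m φ ≠ 0}.Finite}
  zero_mem' := by simp
  add_mem' := by
    rintro φ ψ ⟨h1, h2⟩ ⟨h3, h4⟩
    refine ⟨fun m => by rw [map_add]; exact Submodule.add_mem _ (h1 m) (h3 m),
      (h2.union h4).subset fun m hm => ?_⟩
    by_contra hc
    simp only [Set.mem_union, Set.mem_ofPred_eq, not_or, not_not] at hc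
    exact hm (by rw [map_add, hc.1, hc.2, add_zero])
  smul_mem' := by
    rintro c φ ⟨h1, h2⟩
    refine ⟨fun m => by rw [map_smul]; exact Submodule.smul_mem _ _ (h1 m),
      h2.subset fun m hm => ?_⟩
    intro hc
    exact hm (by rw [map_smul, hc, smul_zero])

/-- Reduces an inclusion to one homogeneous component at a time. The vanishing condition is
automatic for components of operators, and it is what makes the later dimension count exact. -/
theorem finiteComps_le {S : ℤ → Submodule K (ℕ → K)} {P : Submodule K (Module.End K K[X])}
    (h : ∀ m, ∀ f ∈ S m, (∀ n : ℕ, (n : ℤ) < m → f n = 0) → shiftOp m f ∈ P) :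
    finiteComps S ≤ P := by
  rintro φ ⟨h1, h2⟩
  rw [eq_sum_shiftOp_comp (φ := φ) h2.toFinset (by simp)]
  exact Submodule.sum_mem _ fun m _ => h m _ (h1 m) fun n hn => comp_of_lt φ hn

theorem mem_finiteComps_of_homogeneous {S : ℤ → Submodule K (ℕ → K)} {φ : Module.End K K[X]}
    {m : ℤ} (h : ∀ m' ≠ m, comp m' φ = 0) (hm : comp m φ ∈ S m) : φ ∈ finiteComps S := by
  refine ⟨fun m' => ?_, (Set.finite_singleton m).subset fun m' hm' => ?_⟩
  · by_cases hmm : m' = m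
    · rwa [hmm]
    · rw [h m' hmm]
      exact Submodule.zero_mem _
  · by_contra hc
    exact hm' (h m' hc)

end Components

/-! ### Exponential polynomials and difference operators -/

section ExponentialPolynomials

variable {K : Type*} [Field K]

/-- The sequence `n ↦ n ^ p * q ^ (k * n)`. -/
def expPoly (q : K) (i : ℕ × ℤ) : ℕ → K := fun n => (n : K) ^ i.1 * (q ^ i.2) ^ n

/-- The span of the sequences `n ↦ n ^ p * q ^ (k * n)` with `p + |k| ≤ N`. -/
def expPolyLE (q : K) (N : ℤ) : Submodule K (ℕ → K) :=
  Submodule.span K (expPoly q '' {i : ℕ × ℤ | (i.1 : ℤ) + |i.2| ≤ N})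

/-- The span of the sequences `n ↦ n ^ p * q ^ (k * n)`. -/
def expPolys (q : K) : Submodule K (ℕ → K) := Submodule.span K (Set.range (expPoly q))

theorem expPoly_mem_expPolys (q : K) (i : ℕ × ℤ) : expPoly q i ∈ expPolys q :=
  Submodule.subset_span ⟨i, rfl⟩

theorem expPoly_mem_expPolyLE (q : K) {i : ℕ × ℤ} {N : ℤ} (h : (i.1 : ℤ) + |i.2| ≤ N) :
    expPoly q i ∈ expPolyLE q N := Submodule.subset_span ⟨i, h, rfl⟩

theorem expPolyLE_mono (q : K) {N N' : ℤ} (h : N ≤ N') : expPolyLE q N ≤ expPolyLE q N' :=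
  Submodule.span_mono (Set.image_mono fun _ hi => le_trans hi h)

theorem expPolyLE_le_expPolys (q : K) (N : ℤ) : expPolyLE q N ≤ expPolys q :=
  Submodule.span_mono (Set.image_subset_range _ _)

theorem exists_mem_expPolyLE {q : K} {f : ℕ → K} (hf : f ∈ expPolys q) (m : ℤ) :
    ∃ N, m ≤ N ∧ f ∈ expPolyLE q N := by
  induction hf using Submodule.span_induction with
  | mem f hf =>
    obtain ⟨i, rfl⟩ := hf
    exact ⟨max m (i.1 + |i.2|), le_max_left _ _, expPoly_mem_expPolyLE q (le_max_right _ _)⟩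
  | zero => exact ⟨m, le_rfl, Submodule.zero_mem _⟩
  | add f g _ _ hf hg =>
    obtain ⟨N, hN, hf⟩ := hf
    obtain ⟨N', hN', hg⟩ := hg
    exact ⟨max N N', hN.trans (le_max_left _ _), Submodule.add_mem _
      (expPolyLE_mono q (le_max_left _ _) hf) (expPolyLE_mono q (le_max_right _ _) hg)⟩
  | smul c f _ hf =>
    obtain ⟨N, hN, hf⟩ := hf
    exact ⟨N, hN, Submodule.smul_mem _ _ hf⟩

/-- The difference operator `f ↦ (n ↦ f(n + 1) - b f(n))`. -/
def diffOp (b : K) : Module.End K (ℕ → K) := seqShift K - b • 1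

theorem diffOp_apply (b : K) (f : ℕ → K) (n : ℕ) : diffOp b f n = f (n + 1) - b * f n := rfl

theorem diffOp_expPoly {q : K} (b : K) (p : ℕ) (k : ℤ) :
    diffOp b (expPoly q (p, k)) =
      (∑ i ∈ Finset.range p, ((p.choose i : K) * q ^ k) • expPoly q (i, k)) +
        (q ^ k - b) • expPoly q (p, k) := by
  ext n
  simp only [diffOp_apply, expPoly, Pi.add_apply, Finset.sum_apply, Pi.smul_apply, smul_eq_mul]
  push_cast
  rw [add_pow, Finset.sum_range_succ, pow_succ, add_mul, Finset.sum_mul]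
  simp only [one_pow, mul_one, Nat.choose_self, Nat.cast_one]
  have : ∀ i ∈ Finset.range p, (n : K) ^ i * (p.choose i : K) * ((q ^ k) ^ n * q ^ k) =
      (p.choose i : K) * q ^ k * ((n : K) ^ i * (q ^ k) ^ n) := fun i _ => by ring
  rw [Finset.sum_congr rfl this]
  ring

theorem seqShift_mem_expPolys {q : K} {f : ℕ → K} (hf : f ∈ expPolys q) :
    seqShift K f ∈ expPolys q := by
  induction hf using Submodule.span_induction with
  | mem f hf =>
    obtain ⟨⟨p, k⟩, rfl⟩ := hf
    have : seqShift K (expPoly q (p, k)) = diffOp 0 (expPoly q (p, k)) := by simp [diffOp]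
    rw [this, diffOp_expPoly]
    exact Submodule.add_mem _ (Submodule.sum_mem _ fun i _ => Submodule.smul_mem _ _
      (expPoly_mem_expPolys q _)) (Submodule.smul_mem _ _ (expPoly_mem_expPolys q _))
  | zero => simp
  | add f g _ _ hf hg => rw [map_add]; exact Submodule.add_mem _ hf hg
  | smul c f _ hf => rw [map_smul]; exact Submodule.smul_mem _ _ hf

theorem expPoly_mem_map_diffOp [CharZero K] {q : K} (hq0 : q ≠ 0)
    (hq : Function.Injective fun k : ℤ => q ^ k) (a : ℤ) (p : ℕ) (k : ℤ) :
    expPoly q (p, k) ∈ (expPolys q).map (diffOp (q ^ a)) := by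
  induction p using Nat.strong_induction_on with
  | _ p ih =>
    have hsum : ∀ c : ℕ → K, (∑ i ∈ Finset.range p, c i • expPoly q (i, k)) ∈
        (expPolys q).map (diffOp (q ^ a)) := fun c => Submodule.sum_mem _ fun i hi =>
      Submodule.smul_mem _ _ (ih i (Finset.mem_range.mp hi))
    -- In the resonant case the top term of the image cancels. One starts from exponent `p + 1`
    -- instead, and the coefficient `(p + 1) q ^ k` of the next term is nonzero in characteristic
    -- zero.
    by_cases hk : k = a
    · subst hk
      have h := Submodule.mem_map_of_mem (f := diffOp (q ^ k)) (expPoly_mem_expPolys q (p + 1, k))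
      rw [diffOp_expPoly, sub_self, zero_smul, add_zero, Finset.sum_range_succ,
        Submodule.add_mem_iff_right _ (hsum fun i => ((p + 1).choose i : K) * q ^ k)] at h
      refine (Submodule.smul_mem_iff _ (mul_ne_zero ?_ (zpow_ne_zero k hq0))).mp h
      simp only [Nat.choose_succ_self_right]
      exact_mod_cast Nat.succ_ne_zero p
    · have h := Submodule.mem_map_of_mem (f := diffOp (q ^ a)) (expPoly_mem_expPolys q (p, k))
      rw [diffOp_expPoly, Submodule.add_mem_iff_right _ (hsum _)] at h
      exact (Submodule.smul_mem_iff _ (sub_ne_zero.mpr fun h => hk (hq h))).mp h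

/-- The difference operator is onto on exponential polynomials, so `f` differs from an exponential
polynomial by a solution of `g (n + 1) = q ^ a * g n`, which is a multiple of `q ^ (a n)`. -/
theorem mem_expPolys_of_diffOp_mem [CharZero K] {q : K} (hq0 : q ≠ 0)
    (hq : Function.Injective fun k : ℤ => q ^ k) (a : ℤ) {f : ℕ → K}
    (hf : diffOp (q ^ a) f ∈ expPolys q) : f ∈ expPolys q := by
  have hle : expPolys q ≤ (expPolys q).map (diffOp (q ^ a)) := by
    refine Submodule.span_le.mpr ?_
    rintro _ ⟨⟨p, k⟩, rfl⟩
    exact expPoly_mem_map_diffOp hq0 hq a p k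
  obtain ⟨h, hh, hfh⟩ := hle hf
  have hd : ∀ n, (f - h) n = (f - h) 0 * (q ^ a) ^ n := by
    intro n
    induction n with
    | zero => simp
    | succ n ih =>
      have : diffOp (q ^ a) (f - h) n = 0 := by rw [map_sub, hfh, sub_self]; rfl
      rw [diffOp_apply, sub_eq_zero] at this
      rw [this, ih]
      ring
  have : f = h + (f - h) 0 • expPoly q (0, a) := by
    ext n
    have := hd n
    simp only [Pi.add_apply, Pi.smul_apply, expPoly, pow_zero, one_mul, smul_eq_mul, ← this]
    simp
  rw [this]
  exact Submodule.add_mem _ hh (Submodule.smul_mem _ _ (expPoly_mem_expPolys q _))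

/-- The product of the polynomials `X - q ^ a`, for `a` in a list. -/
def annPoly (q : K) (l : List ℤ) : K[X] := (l.map fun a => X - C (q ^ a)).prod

theorem annPoly_cons (q : K) (a : ℤ) (l : List ℤ) :
    annPoly q (a :: l) = (X - C (q ^ a)) * annPoly q l := by simp [annPoly]

theorem annPoly_append (q : K) (l l' : List ℤ) :
    annPoly q (l ++ l') = annPoly q l * annPoly q l' := by simp [annPoly]

theorem aeval_seqShift_X_sub_C (b : K) : aeval (seqShift K) (X - C b) = diffOp b := by
  simp [diffOp, Algebra.algebraMap_eq_smul_one]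

/-- The sequences killed by a product of operators `f ↦ (n ↦ f(n + 1) - q ^ a f(n))`. -/
def annihilated (q : K) : Submodule K (ℕ → K) where
  carrier := {f | ∃ l, aeval (seqShift K) (annPoly q l) f = 0}
  zero_mem' := ⟨[], by simp⟩
  add_mem' := by
    rintro f g ⟨l, hl⟩ ⟨l', hl'⟩
    refine ⟨l ++ l', ?_⟩
    rw [annPoly_append, map_add, map_mul, Module.End.mul_apply, Module.End.mul_apply, hl',
      map_zero, add_zero, ← Module.End.mul_apply, ← map_mul, mul_comm, map_mul,
      Module.End.mul_apply, hl, map_zero]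
  smul_mem' := by
    rintro c f ⟨l, hl⟩
    exact ⟨l, by rw [map_smul, hl, smul_zero]⟩

theorem mem_annihilated_of_diffOp_mem {q : K} {a : ℤ} {f : ℕ → K}
    (h : diffOp (q ^ a) f ∈ annihilated q) : f ∈ annihilated q := by
  obtain ⟨l, hl⟩ := h
  refine ⟨a :: l, ?_⟩
  rw [annPoly_cons, mul_comm, map_mul, Module.End.mul_apply, aeval_seqShift_X_sub_C, hl]

/-- The factor for `q ^ k` lowers the exponent of `n`, so a list with `k` repeated works. -/
theorem expPolys_le_annihilated (q : K) : expPolys q ≤ annihilated q := by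
  refine Submodule.span_le.mpr ?_
  rintro _ ⟨⟨p, k⟩, rfl⟩
  induction p using Nat.strong_induction_on with
  | _ p ih =>
    refine mem_annihilated_of_diffOp_mem (a := k) ?_
    rw [diffOp_expPoly, sub_self, zero_smul, add_zero]
    exact Submodule.sum_mem _ fun i hi => Submodule.smul_mem _ _ (ih i (Finset.mem_range.mp hi))

theorem expPoly_mem_maxGenEigenspace (q : K) (p : ℕ) (k : ℤ) :
    expPoly q (p, k) ∈ (seqShift K).maxGenEigenspace (q ^ k) := by
  induction p using Nat.strong_induction_on with
  | _ p ih =>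
    have h : diffOp (q ^ k) (expPoly q (p, k)) ∈ (seqShift K).maxGenEigenspace (q ^ k) := by
      rw [diffOp_expPoly, sub_self, zero_smul, add_zero]
      exact Submodule.sum_mem _ fun i hi => Submodule.smul_mem _ _ (ih i (Finset.mem_range.mp hi))
    rw [Module.End.mem_maxGenEigenspace] at h ⊢
    obtain ⟨e, he⟩ := h
    exact ⟨e + 1, by rwa [pow_succ, Module.End.mul_apply]⟩

/-- The sequences `n ↦ n ^ p * q ^ (k * n)` are linearly independent. -/
theorem linearIndependent_expPoly [CharZero K] {q : K} (hq0 : q ≠ 0)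
    (hq : Function.Injective fun k : ℤ => q ^ k) : LinearIndependent K (expPoly q) := by
  -- Generalized eigenspaces of the shift for distinct eigenvalues `q ^ k` are independent, which
  -- separates a relation according to `k`.
  have hind : iSupIndep fun k : ℤ => (seqShift K).maxGenEigenspace (q ^ k) :=
    (seqShift K).independent_maxGenEigenspace.comp hq
  rw [iSupIndep_iff_finsetSum_eq_zero_imp_eq_zero] at hind
  refine linearIndependent_iff'.mpr fun s c hc => ?_
  have key : ∀ k ∈ s.image Prod.snd, ∑ i ∈ s with i.2 = k, c i • expPoly q i = 0 := by
    refine hind _ _ (fun k _ => Submodule.sum_mem _ fun i hi => Submodule.smul_mem _ _ ?_) ?_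
    · rw [← (Finset.mem_filter.mp hi).2]
      exact expPoly_mem_maxGenEigenspace q _ _
    · rw [Finset.sum_fiberwise_of_maps_to (fun i hi => Finset.mem_image_of_mem _ hi), hc]
  rintro ⟨p, k⟩ hi
  have h := key k (Finset.mem_image.mpr ⟨_, hi, rfl⟩)
  -- For a fixed `k` the factor `q ^ (k n)` cancels, leaving a polynomial that vanishes at all
  -- natural numbers.
  let P : K[X] := ∑ i ∈ s with i.2 = k, monomial i.1 (c i)
  have hP : P = 0 := by
    refine Polynomial.eq_zero_of_infinite_isRoot _ ((Set.infinite_range_of_injective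
      (Nat.cast_injective (R := K))).mono ?_)
    rintro _ ⟨n, rfl⟩
    have hn := congrFun h n
    have : (∑ i ∈ s with i.2 = k, c i • expPoly q i) n = P.eval (n : K) * (q ^ k) ^ n := by
      simp only [P, eval_finsetSum, eval_monomial, Finset.sum_mul, Finset.sum_apply,
        Pi.smul_apply, smul_eq_mul, expPoly]
      refine Finset.sum_congr rfl fun i hi => ?_
      rw [(Finset.mem_filter.mp hi).2]
      ring
    rw [this] at hn
    exact (mul_eq_zero.mp hn).resolve_right (pow_ne_zero _ (zpow_ne_zero _ hq0))
  have hcoeff : P.coeff p = c (p, k) := by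
    simp only [P, finsetSum_coeff, coeff_monomial]
    rw [Finset.sum_eq_single_of_mem (p, k) (by simp [hi])]
    · simp
    · rintro ⟨p', k'⟩ hi' hne
      rw [Finset.mem_filter] at hi'
      refine if_neg ?_
      rintro rfl
      exact hne (by rw [← hi'.2])
  rw [← hcoeff, hP, coeff_zero]

end ExponentialPolynomials

/-! ### Quantum differential operators are those with exponential polynomial components -/

section QuantumDifferentialOperators

variable {K : Type*} [Field K]

theorem X_mul_mem_finiteComps {q : K} {φ : Module.End K K[X]}
    (hφ : φ ∈ finiteComps fun _ => expPolys q) :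
    LinearMap.mulLeft K X * φ ∈ finiteComps fun _ => expPolys q := by
  refine ⟨fun m => by rw [comp_X_mul]; exact hφ.1 _, ?_⟩
  simp only [comp_X_mul]
  exact hφ.2.preimage (f := fun m : ℤ => m + 1) (add_left_injective 1).injOn

theorem mul_X_mem_finiteComps {q : K} {φ : Module.End K K[X]}
    (hφ : φ ∈ finiteComps fun _ => expPolys q) :
    φ * LinearMap.mulLeft K X ∈ finiteComps fun _ => expPolys q := by
  refine ⟨fun m => by rw [comp_mul_X]; exact seqShift_mem_expPolys (hφ.1 _), ?_⟩
  refine (hφ.2.preimage (f := fun m : ℤ => m + 1) (add_left_injective 1).injOn).subset ?_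
  intro m hm h
  exact hm (by rw [comp_mul_X, h, map_zero])

theorem mulLeft_add (r s : K[X]) :
    LinearMap.mulLeft K (r + s) = LinearMap.mulLeft K r + LinearMap.mulLeft K s :=
  map_add (LinearMap.mul K K[X]) r s

theorem mulLeft_monomial (n : ℕ) (c : K) :
    LinearMap.mulLeft K (monomial n c) = c • LinearMap.mulLeft K (X : K[X]) ^ n := by
  rw [← mulLeft_X_pow, ← C_mul_X_pow_eq_monomial]
  ext
  simp [← smul_eq_C_mul]

theorem mul_mul_mem_finiteComps {q : K} {φ : Module.End K K[X]}
    (hφ : φ ∈ finiteComps fun _ => expPolys q) (r s : K[X]) :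
    LinearMap.mulLeft K r * φ * LinearMap.mulLeft K s ∈ finiteComps fun _ => expPolys q := by
  have hl : LinearMap.mulLeft K r * φ ∈ finiteComps fun _ => expPolys q := by
    induction r using Polynomial.induction_on' with
    | add r r' h h' => rw [mulLeft_add, add_mul]; exact Submodule.add_mem _ h h'
    | monomial n c =>
      rw [mulLeft_monomial, smul_mul_assoc]
      refine Submodule.smul_mem _ _ ?_
      induction n with
      | zero => simpa using hφ
      | succ n ih => rw [pow_succ', mul_assoc]; exact X_mul_mem_finiteComps ih
  induction s using Polynomial.induction_on' with
  | add r r' h h' => rw [mulLeft_add, mul_add]; exact Submodule.add_mem _ h h'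
  | monomial n c =>
    rw [mulLeft_monomial, mul_smul_comm]
    refine Submodule.smul_mem _ _ ?_
    induction n with
    | zero => simpa using hl
    | succ n ih => rw [pow_succ, ← mul_assoc]; exact mul_X_mem_finiteComps ih

/-- The bracket with `x` alone suffices: on coefficient sequences it is the difference operator for
`q ^ a`, which reflects membership in `expPolys`. -/
theorem bimoduleSpan_commutesModulo_le [CharZero K] {q : K} (hq0 : q ≠ 0)
    (hq : Function.Injective fun k : ℤ => q ^ k) {N : Submodule K (Module.End K K[X])}
    (hN : N ≤ finiteComps fun _ => expPolys q) :
    bimoduleSpan (commutesModulo (polyGrading K) (bichar q) N) ≤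
      finiteComps fun _ => expPolys q := by
  refine Submodule.span_le.mpr ?_
  rintro _ ⟨φ, ⟨⟨d, hd⟩, a, ha⟩, r, s, rfl⟩
  refine mul_mul_mem_finiteComps ?_ r s
  refine mem_finiteComps_of_homogeneous (mem_homogeneousEnd.mp hd) ?_
  have hX : (X : K[X]) ∈ polyGrading K 1 := Submodule.subset_span ⟨1, by simp⟩
  have h := (hN (ha 1 X hX)).1 (-d - 1)
  rw [map_sub, map_smul, comp_X_mul, comp_mul_X, sub_add_cancel, bichar, mul_one] at h
  exact mem_expPolys_of_diffOp_mem hq0 hq a h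

theorem DqPoly_le_finiteComps [CharZero K] {q : K} (hq0 : q ≠ 0)
    (hq : Function.Injective fun k : ℤ => q ^ k) :
    DqPoly q ≤ finiteComps fun _ => expPolys q := by
  refine iSup_le fun i => ?_
  induction i with
  | zero => exact bimoduleSpan_commutesModulo_le hq0 hq bot_le
  | succ i ih => exact bimoduleSpan_commutesModulo_le hq0 hq ih

theorem subset_bimoduleSpan (S : Set (Module.End K K[X])) : S ⊆ bimoduleSpan S :=
  fun φ hφ => Submodule.subset_span ⟨φ, hφ, 1, 1, by
    rw [LinearMap.mulLeft_one]; exact (one_mul (φ * 1)).symm ▸ (mul_one φ).symm⟩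

/-- Bracketing consumes one factor of the annihilating product, so the number of factors bounds the
order. -/
theorem mem_commutesModulo_of_annihilated {q : K}
    {N : Submodule K (Module.End K K[X])} {m : ℤ} {φ : Module.End K K[X]} {a : ℤ} {l : List ℤ}
    (hφ : ∀ m' ≠ m, comp m' φ = 0)
    (hl : aeval (seqShift K) (annPoly q (a :: l)) (comp m φ) = 0)
    (hN : ∀ (m : ℤ) (ψ : Module.End K K[X]), (∀ m' ≠ m, comp m' ψ = 0) →
      aeval (seqShift K) (annPoly q l) (comp m ψ) = 0 → ψ ∈ N) :
    φ ∈ commutesModulo (polyGrading K) (bichar q) N := by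
  refine ⟨⟨-m, mem_homogeneousEnd.mpr (by simpa using hφ)⟩, a, fun e r hr => ?_⟩
  induction hr using Submodule.span_induction with
  | zero => simp
  | add r s _ _ hr hs =>
    rw [mulLeft_add, mul_add, add_mul, smul_add, add_sub_add_comm]
    exact Submodule.add_mem _ hr hs
  | smul c r _ hr =>
    have : LinearMap.mulLeft K (c • r) = c • LinearMap.mulLeft K r := by ext; simp
    rw [this]
    convert Submodule.smul_mem N c hr using 1
    ext p
    simp [mul_sub, mul_left_comm]
  | mem r hr =>
    obtain ⟨n, rfl, rfl⟩ := hr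
    have hcomp : ∀ m', comp m' (φ * LinearMap.mulLeft K (X ^ n) -
        bichar q a n • (LinearMap.mulLeft K (X ^ n) * φ)) =
        aeval (seqShift K) (X ^ n - C (q ^ a) ^ n) (comp (m' + n) φ) := by
      intro m'
      rw [map_sub, map_smul, mulLeft_X_pow, comp_X_pow_mul, comp_mul_X_pow, bichar, zpow_mul,
        zpow_natCast, map_sub, ← C_pow, aeval_C, map_pow, aeval_X, LinearMap.sub_apply,
        Module.algebraMap_end_apply]
    refine hN (m - n) _ (fun m' hm' => ?_) ?_
    · rw [hcomp, hφ _ (by omega), map_zero]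
    · rw [hcomp, sub_add_cancel, ← Module.End.mul_apply, ← map_mul]
      -- The bracket with `x ^ n` acts as `S ^ n - q ^ (a n)`, where `S` is the shift. It is
      -- divisible by `S - q ^ a` and so supplies the factor indexed by `a`.
      obtain ⟨Q, hQ⟩ := sub_dvd_pow_sub_pow (X : K[X]) (C (q ^ a)) n
      rw [hQ, mul_left_comm, ← mul_assoc, ← annPoly_cons, mul_comm, map_mul,
        Module.End.mul_apply, hl, map_zero]

theorem mem_DqPoly_of_annihilated {q : K} {m : ℤ} {φ : Module.End K K[X]}
    (hφ : ∀ m' ≠ m, comp m' φ = 0) (h : comp m φ ∈ annihilated q) : φ ∈ DqPoly q := by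
  have key : ∀ (l : List ℤ) (a m : ℤ) (φ : Module.End K K[X]), (∀ m' ≠ m, comp m' φ = 0) →
      aeval (seqShift K) (annPoly q (a :: l)) (comp m φ) = 0 →
      φ ∈ quantumDiffOrder (polyGrading K) (bichar q) l.length := by
    intro l
    induction l with
    | nil =>
      intro a m φ hφ h
      refine subset_bimoduleSpan _ (mem_commutesModulo_of_annihilated hφ h
        fun m ψ hψ hz => ?_)
      refine (Submodule.mem_bot K).mpr (comp_ext fun m' => ?_)
      rw [map_zero]
      by_cases hm : m' = m
      · subst hm
        simpa [annPoly] using hz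
      · exact hψ m' hm
    | cons b l ih =>
      intro a m φ hφ h
      exact subset_bimoduleSpan _ (mem_commutesModulo_of_annihilated hφ h (ih b))
  obtain ⟨l, hl⟩ := h
  -- Order zero already takes one factor. A superfluous factor, for the exponent `0`, makes the list
  -- nonempty.
  refine Submodule.mem_iSup_of_mem l.length (key l 0 m φ hφ ?_)
  rw [annPoly_cons, map_mul, Module.End.mul_apply, hl, map_zero]

end QuantumDifferentialOperators

/-! ### Action of the generators on coefficient sequences -/

section Lowering

variable {K : Type*} [Field K]

theorem del_X_pow (q : K) (a : ℤ) (n : ℕ) :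
    del q a (X ^ n) = qNum n (q ^ a) • (X : K[X]) ^ (n - 1) := by
  have := (basisMonomials K).constr_basis K
    (fun n : ℕ => qNum n (q ^ a) • (X : K[X]) ^ (n - 1)) n
  simpa [del, X_pow_eq_monomial] using this

theorem coeffInt_del (q : K) (a z : ℤ) (p : K[X]) :
    coeffInt z (del q a p) = qNum (z + 1).toNat (q ^ a) * coeffInt (z + 1) p := by
  induction p using Polynomial.induction_on' with
  | add p r hp hr => simp only [map_add, hp, hr, mul_add]
  | monomial n c =>
    rw [← C_mul_X_pow_eq_monomial, ← smul_eq_C_mul]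
    simp only [map_smul, del_X_pow, coeffInt_X_pow, smul_eq_mul]
    rcases n with _ | n
    · simp only [qNum, Finset.range_zero, Finset.sum_empty, zero_mul, mul_zero, Nat.cast_zero]
      split_ifs with h
      · simp [h]
      · simp
    · simp only [add_tsub_cancel_right, Nat.cast_add, Nat.cast_one, add_left_inj]
      split_ifs with h
      · subst h
        have : ((n : ℤ) + 1).toNat = n + 1 := by omega
        rw [this]
        ring
      · simp

/-- The derivation acts on `x ^ (n - m)`, whence the bracket of `n - m`. Truncation by `toNat` is
harmless, because `comp m φ n` vanishes when `n < m`. The three closed forms below hold for all `n`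
for the same reason. -/
theorem comp_del_mul (q : K) (a m : ℤ) (φ : Module.End K K[X]) (n : ℕ) :
    comp (m + 1) (del q a * φ) n = qNum (n - m).toNat (q ^ a) * comp m φ n := by
  rw [comp_apply, Module.End.mul_apply, coeffInt_del, comp_apply]
  congr 3 <;> ring_nf

theorem qNum_one (n : ℕ) : qNum n (1 : K) = n := by simp [qNum]

theorem qNum_of_ne_one {t : K} (ht : t ≠ 1) (n : ℕ) : qNum n t = (t ^ n - 1) / (t - 1) :=
  geom_sum_eq ht n

theorem comp_del_zero_mul (q : K) (m : ℤ) (φ : Module.End K K[X]) (n : ℕ) :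
    comp (m + 1) (del q 0 * φ) n = (n - m) * comp m φ n := by
  rw [comp_del_mul, zpow_zero, qNum_one]
  rcases lt_or_ge (n : ℤ) m with h | h
  · rw [comp_of_lt φ h, mul_zero, mul_zero]
  · congr 1
    have : (((n - m).toNat : ℤ) : K) = ((n - m : ℤ) : K) := by rw [Int.toNat_of_nonneg (by omega)]
    rw [Int.cast_natCast] at this
    simpa only [Int.cast_sub, Int.cast_natCast] using this

theorem comp_del_one_mul {q : K} (hq0 : q ≠ 0) (hq1 : q ≠ 1) (m : ℤ) (φ : Module.End K K[X])
    (n : ℕ) : comp (m + 1) (del q 1 * φ) n =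
      (q ^ m * (q - 1))⁻¹ * (q ^ n - q ^ m) * comp m φ n := by
  rw [comp_del_mul, zpow_one, qNum_of_ne_one hq1]
  rcases lt_or_ge (n : ℤ) m with h | h
  · rw [comp_of_lt φ h, mul_zero, mul_zero]
  · congr 1
    have : q ^ (n - m).toNat = q ^ n / q ^ m := by
      rw [← zpow_natCast, Int.toNat_of_nonneg (by omega), zpow_sub₀ hq0, zpow_natCast]
    have h1 := sub_ne_zero.mpr hq1
    have h2 := zpow_ne_zero m hq0
    rw [this]
    field_simp

theorem comp_del_neg_one_mul {q : K} (hq0 : q ≠ 0) (hq1 : q ≠ 1) (m : ℤ)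
    (φ : Module.End K K[X]) (n : ℕ) : comp (m + 1) (del q (-1) * φ) n =
      (1 - q⁻¹)⁻¹ * ((q ^ n - q ^ m) * (q ^ n)⁻¹) * comp m φ n := by
  have hq1' : q⁻¹ ≠ 1 := by simpa using hq1
  rw [comp_del_mul, zpow_neg_one, qNum_of_ne_one hq1']
  rcases lt_or_ge (n : ℤ) m with h | h
  · rw [comp_of_lt φ h, mul_zero, mul_zero]
  · congr 1
    have : q⁻¹ ^ (n - m).toNat = q ^ m / q ^ n := by
      rw [inv_pow, ← zpow_natCast, Int.toNat_of_nonneg (by omega), zpow_sub₀ hq0, zpow_natCast,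
        inv_div]
    have h1 : q⁻¹ - 1 ≠ 0 := sub_ne_zero.mpr hq1'
    have h2 : q ^ n ≠ 0 := pow_ne_zero n hq0
    have h3 : (1 - q⁻¹)⁻¹ = -(q⁻¹ - 1)⁻¹ := by rw [← neg_sub, inv_neg]
    rw [this, h3, div_eq_mul_inv, mul_comm]
    rw [neg_mul, ← mul_neg]
    congr 1
    field_simp
    ring

end Lowering

/-! ### Growth of the filtration by $p+|k|$ -/

section BoundedComponents

variable {K : Type*} [Field K] {q : K}

theorem natCast_mul_mem_expPolyLE {N : ℤ} {f : ℕ → K} (hf : f ∈ expPolyLE q N) :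
    (fun n : ℕ => (n : K)) * f ∈ expPolyLE q (N + 1) := by
  induction hf using Submodule.span_induction with
  | mem f hf =>
    obtain ⟨⟨p, k⟩, hi, rfl⟩ := hf
    have : (fun n : ℕ => (n : K)) * expPoly q (p, k) = expPoly q (p + 1, k) := by
      ext n
      simp only [expPoly, Pi.mul_apply]
      ring
    rw [this]
    refine expPoly_mem_expPolyLE q ?_
    simp only [Set.mem_ofPred_eq] at hi
    push_cast
    omega
  | zero => rw [mul_zero]; exact Submodule.zero_mem _
  | add f g _ _ hf hg => rw [mul_add]; exact Submodule.add_mem _ hf hg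
  | smul c f _ hf => rw [mul_smul_comm]; exact Submodule.smul_mem _ c hf

theorem zpow_mul_mem_expPolyLE (hq0 : q ≠ 0) {N : ℤ} {f : ℕ → K} (hf : f ∈ expPolyLE q N)
    {a : ℤ} (ha : |a| ≤ 1) : (fun n : ℕ => (q ^ a) ^ n) * f ∈ expPolyLE q (N + 1) := by
  induction hf using Submodule.span_induction with
  | mem f hf =>
    obtain ⟨⟨p, k⟩, hi, rfl⟩ := hf
    have : (fun n : ℕ => (q ^ a) ^ n) * expPoly q (p, k) = expPoly q (p, k + a) := by
      ext n
      simp only [expPoly, Pi.mul_apply]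
      rw [zpow_add₀ hq0]
      ring
    rw [this]
    refine expPoly_mem_expPolyLE q ?_
    simp only [Set.mem_ofPred_eq] at hi
    have := abs_add_le k a
    push_cast
    omega
  | zero => rw [mul_zero]; exact Submodule.zero_mem _
  | add f g _ _ hf hg => rw [mul_add]; exact Submodule.add_mem _ hf hg
  | smul c f _ hf => rw [mul_smul_comm]; exact Submodule.smul_mem _ c hf

/-- The multipliers are combinations of `1`, `n` and `q ^ (±n)`, each of which raises `p + |k|` by
at most one. -/
theorem comp_del_mul_mem_expPolyLE (hq0 : q ≠ 0) (hq1 : q ≠ 1) {a : ℤ} (ha : |a| ≤ 1) {m N : ℤ}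
    {φ : Module.End K K[X]} (h : comp m φ ∈ expPolyLE q N) :
    comp (m + 1) (del q a * φ) ∈ expPolyLE q (N + 1) := by
  have h' := expPolyLE_mono q (by omega : N ≤ N + 1) h
  obtain rfl | rfl | rfl : a = 0 ∨ a = 1 ∨ a = -1 := by
    rw [abs_le] at ha
    omega
  · have : comp (m + 1) (del q 0 * φ) =
        (fun n : ℕ => (n : K) * comp m φ n) - (m : K) • comp m φ := by
      ext n
      rw [comp_del_zero_mul, Pi.sub_apply, Pi.smul_apply, smul_eq_mul, sub_mul]
    rw [this]
    exact Submodule.sub_mem _ (natCast_mul_mem_expPolyLE h) (Submodule.smul_mem _ _ h')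
  · have : comp (m + 1) (del q 1 * φ) = (q ^ m * (q - 1))⁻¹ •
        ((fun n : ℕ => (q ^ (1 : ℤ)) ^ n * comp m φ n) - q ^ m • comp m φ) := by
      ext n
      rw [comp_del_one_mul hq0 hq1, Pi.smul_apply, Pi.sub_apply, Pi.smul_apply, zpow_one]
      simp only [smul_eq_mul]
      ring
    rw [this]
    exact Submodule.smul_mem _ _ (Submodule.sub_mem _ (zpow_mul_mem_expPolyLE hq0 h ha)
      (Submodule.smul_mem _ _ h'))
  · have : comp (m + 1) (del q (-1) * φ) = (1 - q⁻¹)⁻¹ •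
        (comp m φ - q ^ m • (fun n : ℕ => (q ^ (-1 : ℤ)) ^ n * comp m φ n)) := by
      ext n
      have hn := pow_ne_zero n hq0
      rw [comp_del_neg_one_mul hq0 hq1, Pi.smul_apply, Pi.sub_apply, Pi.smul_apply, zpow_neg_one]
      simp only [smul_eq_mul, inv_pow]
      field_simp
    rw [this]
    exact Submodule.smul_mem _ _ (Submodule.sub_mem _ h'
      (Submodule.smul_mem _ _ (zpow_mul_mem_expPolyLE hq0 h ha)))

end BoundedComponents

/-! ### Coefficient sequences of words in the lowering operators -/

section LoweringWords

variable {K : Type*} [Field K]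

/-- The sequence `n ↦ ∏ (n - i) * ∏ (q ^ n - q ^ j) * q ^ (-r n)`, `i ∈ I`, `j ∈ J`. -/
def symFun (q : K) (I J : Finset ℕ) (r n : ℕ) : K :=
  (∏ i ∈ I, ((n : K) - i)) * ((∏ j ∈ J, (q ^ n - q ^ j)) * ((q ^ n)⁻¹) ^ r)

/-- The operator `φ` lowers degrees by `M`, with coefficient function a nonzero multiple of
`symFun q I J r`. -/
structure Lowers (q : K) (φ : Module.End K K[X]) (M : ℕ) (I J : Finset ℕ) (r : ℕ) : Prop where
  left_subset : I ⊆ Finset.range M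
  right_subset : J ⊆ Finset.range M
  mem_expPolyLE : comp M φ ∈ expPolyLE q M
  comp_of_ne : ∀ m : ℤ, m ≠ M → comp m φ = 0
  exists_comp : ∃ c : K, c ≠ 0 ∧ ∀ n, comp M φ n = c * symFun q I J r n

theorem lowers_one (q : K) : Lowers q 1 0 ∅ ∅ 0 where
  left_subset := by simp
  right_subset := by simp
  mem_expPolyLE := by
    have : comp ((0 : ℕ) : ℤ) (1 : Module.End K K[X]) = expPoly q (0, 0) := by
      ext n
      simp [comp_apply, coeffInt_X_pow, expPoly]
    rw [this]
    exact expPoly_mem_expPolyLE q (by simp)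
  comp_of_ne m hm := by
    ext n
    rw [comp_apply, Module.End.one_apply, coeffInt_X_pow, if_neg]
    · rfl
    · intro h
      push_cast at hm
      omega
  exists_comp := ⟨1, one_ne_zero, fun n => by
    simp [comp_apply, coeffInt_X_pow, symFun]⟩

variable {q : K} {φ : Module.End K K[X]} {M : ℕ} {I J : Finset ℕ} {r : ℕ}

theorem comp_del_mul_of_ne {a m : ℤ} (h : comp (m - 1) φ = 0) : comp m (del q a * φ) = 0 := by
  ext n
  have := comp_del_mul q a (m - 1) φ n
  rw [sub_add_cancel] at this
  simp [this, h]

theorem Lowers.del_zero_mul (hq0 : q ≠ 0) (hq1 : q ≠ 1) (h : Lowers q φ M I J r) :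
    Lowers q (del q 0 * φ) (M + 1) (I ∪ {M}) J r where
  left_subset := Finset.union_subset (h.left_subset.trans (by simp)) (by simp)
  right_subset := h.right_subset.trans (by simp)
  mem_expPolyLE := by
    rw [Nat.cast_add, Nat.cast_one]
    exact comp_del_mul_mem_expPolyLE hq0 hq1 (by simp) h.mem_expPolyLE
  comp_of_ne m hm := comp_del_mul_of_ne (h.comp_of_ne _ (by push_cast at hm; omega))
  exists_comp := by
    obtain ⟨c, hc, hf⟩ := h.exists_comp
    refine ⟨c, hc, fun n => ?_⟩
    have hM : Disjoint I {M} := by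
      simpa using fun hM => Finset.notMem_range_self (h.left_subset hM)
    rw [Nat.cast_add, Nat.cast_one, comp_del_zero_mul, hf, symFun, symFun,
      Finset.prod_union hM, Finset.prod_singleton, Int.cast_natCast]
    ring

theorem Lowers.del_one_mul (hq0 : q ≠ 0) (hq1 : q ≠ 1) (h : Lowers q φ M I J r) :
    Lowers q (del q 1 * φ) (M + 1) I (J ∪ {M}) r where
  left_subset := h.left_subset.trans (by simp)
  right_subset := Finset.union_subset (h.right_subset.trans (by simp)) (by simp)
  mem_expPolyLE := by
    rw [Nat.cast_add, Nat.cast_one]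
    exact comp_del_mul_mem_expPolyLE hq0 hq1 (by simp) h.mem_expPolyLE
  comp_of_ne m hm := comp_del_mul_of_ne (h.comp_of_ne _ (by push_cast at hm; omega))
  exists_comp := by
    obtain ⟨c, hc, hf⟩ := h.exists_comp
    refine ⟨(q ^ M * (q - 1))⁻¹ * c, mul_ne_zero (inv_ne_zero (mul_ne_zero (pow_ne_zero _ hq0)
      (sub_ne_zero.mpr hq1))) hc, fun n => ?_⟩
    have hM : Disjoint J {M} := by
      simpa using fun hM => Finset.notMem_range_self (h.right_subset hM)
    rw [Nat.cast_add, Nat.cast_one, comp_del_one_mul hq0 hq1, hf, symFun, symFun,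
      Finset.prod_union hM, Finset.prod_singleton, zpow_natCast]
    ring

theorem Lowers.del_neg_one_mul (hq0 : q ≠ 0) (hq1 : q ≠ 1) (h : Lowers q φ M I J r) :
    Lowers q (del q (-1) * φ) (M + 1) I (J ∪ {M}) (r + 1) where
  left_subset := h.left_subset.trans (by simp)
  right_subset := Finset.union_subset (h.right_subset.trans (by simp)) (by simp)
  mem_expPolyLE := by
    rw [Nat.cast_add, Nat.cast_one]
    exact comp_del_mul_mem_expPolyLE hq0 hq1 (by simp) h.mem_expPolyLE
  comp_of_ne m hm := comp_del_mul_of_ne (h.comp_of_ne _ (by push_cast at hm; omega))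
  exists_comp := by
    obtain ⟨c, hc, hf⟩ := h.exists_comp
    refine ⟨(1 - q⁻¹)⁻¹ * c, mul_ne_zero (inv_ne_zero (sub_ne_zero.mpr ?_)) hc, fun n => ?_⟩
    · intro h'
      exact hq1 (inv_eq_one.mp h'.symm)
    have hM : Disjoint J {M} := by
      simpa using fun hM => Finset.notMem_range_self (h.right_subset hM)
    rw [Nat.cast_add, Nat.cast_one, comp_del_neg_one_mul hq0 hq1, hf, symFun, symFun,
      Finset.prod_union hM, Finset.prod_singleton, zpow_natCast]
    ring

theorem union_Ico_union_singleton (I : Finset ℕ) (M k : ℕ) :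
    I ∪ Finset.Ico M (M + k) ∪ {M + k} = I ∪ Finset.Ico M (M + (k + 1)) := by
  ext i
  simp only [Finset.mem_union, Finset.mem_Ico, Finset.mem_singleton, or_assoc]
  have : (M ≤ i ∧ i < M + k) ∨ i = M + k ↔ M ≤ i ∧ i < M + (k + 1) := by omega
  rw [this]

theorem Lowers.del_zero_pow_mul (hq0 : q ≠ 0) (hq1 : q ≠ 1) (h : Lowers q φ M I J r) (k : ℕ) :
    Lowers q (del q 0 ^ k * φ) (M + k) (I ∪ Finset.Ico M (M + k)) J r := by
  induction k with
  | zero => simpa using h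
  | succ k ih =>
    rw [pow_succ', mul_assoc, ← union_Ico_union_singleton]
    exact ih.del_zero_mul hq0 hq1

theorem Lowers.del_one_pow_mul (hq0 : q ≠ 0) (hq1 : q ≠ 1) (h : Lowers q φ M I J r) (k : ℕ) :
    Lowers q (del q 1 ^ k * φ) (M + k) I (J ∪ Finset.Ico M (M + k)) r := by
  induction k with
  | zero => simpa using h
  | succ k ih =>
    rw [pow_succ', mul_assoc, ← union_Ico_union_singleton]
    exact ih.del_one_mul hq0 hq1

theorem Lowers.del_neg_one_pow_mul (hq0 : q ≠ 0) (hq1 : q ≠ 1) (h : Lowers q φ M I J r) (k : ℕ) :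
    Lowers q (del q (-1) ^ k * φ) (M + k) I (J ∪ Finset.Ico M (M + k)) (r + k) := by
  induction k with
  | zero => simpa using h
  | succ k ih =>
    rw [pow_succ', mul_assoc, ← union_Ico_union_singleton]
    exact ih.del_neg_one_mul hq0 hq1

end LoweringWords

/-! ### Symbols: formal polynomials in $n$ and $q^n$ -/

section Symbols

open scoped LaurentPolynomial

variable {K : Type*} [Field K]

/-- Evaluation of Laurent polynomials at `q ^ n`. -/
def laurentEval (q : Kˣ) (n : ℕ) : K[T;T⁻¹] →+* K :=
  LaurentPolynomial.eval₂ (RingHom.id K) (q ^ n)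

theorem laurentEval_smul (q : Kˣ) (n : ℕ) (c : K) (L : K[T;T⁻¹]) :
    laurentEval q n (c • L) = c * laurentEval q n L := by
  rw [LaurentPolynomial.smul_eq_C_mul, map_mul, laurentEval, LaurentPolynomial.eval₂_C,
    RingHom.id_apply]

/-- Evaluation at `q ^ n` as a linear map. -/
def laurentEvalLin (q : Kˣ) (n : ℕ) : K[T;T⁻¹] →ₗ[K] K where
  toFun := laurentEval q n
  map_add' := map_add _
  map_smul' := laurentEval_smul q n

theorem laurentEval_T (q : Kˣ) (n : ℕ) (k : ℤ) :
    laurentEval q n (LaurentPolynomial.T k) = ((q : K) ^ k) ^ n := by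
  rw [laurentEval, LaurentPolynomial.eval₂_T, Units.val_zpow_eq_zpow_val, Units.val_pow_eq_pow_val,
    ← zpow_natCast, ← zpow_natCast, ← zpow_mul, ← zpow_mul, mul_comm]

theorem laurentEval_C (q : Kˣ) (n : ℕ) (c : K) :
    laurentEval q n (LaurentPolynomial.C c) = c := LaurentPolynomial.eval₂_C _ _ _

/-- Evaluation at `X = n`, `T = q ^ n`. -/
def symbolEvalAt (q : Kˣ) (n : ℕ) : K[T;T⁻¹][X] →+* K := eval₂RingHom (laurentEval q n) (n : K)

/-- The sequence `n ↦ F(n, q ^ n)` defined by a polynomial `F` over the Laurent polynomials. -/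
def symbolEval (q : Kˣ) : K[T;T⁻¹][X] →ₗ[K] (ℕ → K) where
  toFun F n := symbolEvalAt q n F
  map_add' F G := by ext n; simp
  map_smul' c F := by
    ext n
    have : c • F = C (LaurentPolynomial.C c) * F := by
      ext1 i
      rw [coeff_smul, coeff_C_mul, LaurentPolynomial.smul_eq_C_mul]
    rw [this]
    simp [symbolEvalAt, laurentEval_C]

theorem symbolEval_monomial (q : Kˣ) (p : ℕ) (k : ℤ) :
    symbolEval q (monomial p (LaurentPolynomial.T k)) = expPoly (q : K) (p, k) := by
  ext n
  change eval₂ _ _ _ = _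
  rw [eval₂_monomial, laurentEval_T, expPoly, mul_comm]

/-- Makes the formal symbol of a sequence unique, so that its leading coefficients may be read off
from the sequence. -/
theorem symbolEval_injective [CharZero K] (q : Kˣ)
    (hq : Function.Injective fun k : ℤ => (q : K) ^ k) :
    Function.Injective (symbolEval q) := by
  let j : (ℕ × ℤ →₀ K) →ₗ[K] K[T;T⁻¹][X] :=
    Finsupp.linearCombination K fun i => monomial i.1 (LaurentPolynomial.T i.2)
  have hj : ∀ F, ∃ c, j c = F := by
    intro F
    induction F using Polynomial.induction_on' with
    | add F G hF hG =>
      obtain ⟨c, rfl⟩ := hF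
      obtain ⟨d, rfl⟩ := hG
      exact ⟨c + d, map_add _ _ _⟩
    | monomial p L =>
      induction L using LaurentPolynomial.induction_on' with
      | add F G hF hG =>
        obtain ⟨c, hc⟩ := hF
        obtain ⟨d, hd⟩ := hG
        exact ⟨c + d, by rw [map_add, hc, hd, map_add]⟩
      | C_mul_T k a =>
        refine ⟨Finsupp.single (p, k) a, ?_⟩
        rw [Finsupp.linearCombination_single, smul_monomial, LaurentPolynomial.smul_eq_C_mul]
  have hcomp : symbolEval q ∘ₗ j = Finsupp.linearCombination K (expPoly (q : K)) := by
    refine Finsupp.lhom_ext fun i a => ?_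
    rw [LinearMap.comp_apply, Finsupp.linearCombination_single,
      Finsupp.linearCombination_single, map_smul, symbolEval_monomial]
  refine (injective_iff_map_eq_zero (symbolEval q)).mpr fun F hF => ?_
  obtain ⟨c, rfl⟩ := hj F
  have hli : LinearIndependent K (expPoly (q : K)) := linearIndependent_expPoly q.ne_zero hq
  have hc : c = 0 := by
    refine linearIndependent_iff.mp hli c ?_
    rw [← hcomp, LinearMap.comp_apply, hF]
  rw [hc, map_zero]

/-- The Laurent polynomial `∏ (T - q ^ j) * T ^ (-r)`, `j ∈ J`. -/
def laurentSymbol (q : Kˣ) (J : Finset ℕ) (r : ℕ) : K[T;T⁻¹] :=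
  toLaurent (∏ j ∈ J, (X - C ((q : K) ^ j))) * LaurentPolynomial.T (-r)

/-- The polynomial whose value at `X = n`, `T = q ^ n` is `symFun q I J r n`. -/
def symbol (q : Kˣ) (I J : Finset ℕ) (r : ℕ) : K[T;T⁻¹][X] :=
  C (laurentSymbol q J r) * ∏ i ∈ I, (X - C (LaurentPolynomial.C (i : K)))

theorem laurentEval_laurentSymbol (q : Kˣ) (J : Finset ℕ) (r n : ℕ) :
    laurentEval q n (laurentSymbol q J r) =
      (∏ j ∈ J, ((q : K) ^ n - (q : K) ^ j)) * (((q : K) ^ n)⁻¹) ^ r := by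
  rw [laurentSymbol, map_mul, laurentEval_T, zpow_neg, zpow_natCast, inv_pow, inv_pow, pow_right_comm]
  congr 1
  rw [laurentEval, LaurentPolynomial.eval₂_toLaurent, eval₂_finsetProd]
  simp

theorem symbolEval_symbol (q : Kˣ) (I J : Finset ℕ) (r : ℕ) :
    symbolEval q (symbol q I J r) = symFun (q : K) I J r := by
  ext n
  change eval₂ _ _ _ = _
  rw [symbol, eval₂_mul, eval₂_C, laurentEval_laurentSymbol, eval₂_finsetProd, symFun, mul_comm]
  congr 1
  refine Finset.prod_congr rfl fun i _ => ?_
  rw [eval₂_sub, eval₂_X, eval₂_C, laurentEval_C]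

theorem natDegree_prod_X_sub_C {R : Type*} [CommRing R] [Nontrivial R] (I : Finset ℕ)
    (a : ℕ → R) : (∏ i ∈ I, (X - C (a i))).natDegree = I.card := by
  rw [natDegree_prod_of_monic _ _ fun i _ => monic_X_sub_C _]
  simp

theorem coeff_symbol_card (q : Kˣ) (I J : Finset ℕ) (r : ℕ) :
    (symbol q I J r).coeff I.card = laurentSymbol q J r := by
  rw [symbol, coeff_C_mul]
  have h := (monic_prod_of_monic I (fun i : ℕ => X - C (LaurentPolynomial.C (i : K)))
    fun i _ => monic_X_sub_C _).coeff_natDegree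
  rw [natDegree_prod_X_sub_C] at h
  rw [h, mul_one]

theorem coeff_symbol_of_lt (q : Kˣ) {I : Finset ℕ} (J : Finset ℕ) (r : ℕ) {p : ℕ}
    (h : I.card < p) : (symbol q I J r).coeff p = 0 := by
  rw [symbol, coeff_C_mul, coeff_eq_zero_of_natDegree_lt, mul_zero]
  rwa [natDegree_prod_X_sub_C I fun i => LaurentPolynomial.C (i : K)]

/-- It follows that the exponents occurring lie between `-r` and `J.card - r`. Both end coefficients
are nonzero: the top one is `1`, and the bottom one is a product of the `-q ^ j`. -/
theorem coeff_laurentSymbol (q : Kˣ) (J : Finset ℕ) (r : ℕ) (z : ℤ) :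
    (laurentSymbol q J r).coeff z = coeffInt (z + r) (∏ j ∈ J, (X - C ((q : K) ^ j))) := by
  rw [laurentSymbol]
  generalize (∏ j ∈ J, (X - C ((q : K) ^ j))) = P
  induction P using Polynomial.induction_on' with
  | add P Q hP hQ => rw [map_add, add_mul, map_add, ← hP, ← hQ]; rfl
  | monomial n c =>
    rw [← C_mul_X_pow_eq_monomial, toLaurent_C_mul_X_pow, mul_assoc, ← LaurentPolynomial.T_add,
      ← smul_eq_C_mul, map_smul, coeffInt_X_pow, ← LaurentPolynomial.single_eq_C_mul_T]
    simp only [AddMonoidAlgebra.coeff_single, Finsupp.single_apply, smul_eq_mul, mul_ite, mul_one,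
      mul_zero]
    congr 1
    simp only [eq_iff_iff]
    omega

theorem coeff_laurentSymbol_of_lt (q : Kˣ) (J : Finset ℕ) {r : ℕ} {z : ℤ} (h : z + r < 0) :
    (laurentSymbol q J r).coeff z = 0 := by
  rw [coeff_laurentSymbol, coeffInt_of_neg h]

theorem coeff_laurentSymbol_of_gt (q : Kˣ) {J : Finset ℕ} {r : ℕ} {z : ℤ}
    (h : (J.card : ℤ) < z + r) : (laurentSymbol q J r).coeff z = 0 := by
  obtain ⟨n, hn⟩ : ∃ n : ℕ, z + r = n := ⟨(z + r).toNat, by omega⟩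
  rw [coeff_laurentSymbol, hn, coeffInt_natCast, coeff_eq_zero_of_natDegree_lt]
  rw [natDegree_prod_X_sub_C J fun j => (q : K) ^ j]
  omega

theorem coeff_laurentSymbol_card (q : Kˣ) {J : Finset ℕ} {r : ℕ} {z : ℤ}
    (h : z + r = J.card) : (laurentSymbol q J r).coeff z = 1 := by
  have h' := (monic_prod_of_monic J (fun j : ℕ => X - C ((q : K) ^ j))
    fun i _ => monic_X_sub_C _).coeff_natDegree
  rw [natDegree_prod_X_sub_C] at h'
  rw [coeff_laurentSymbol, h, coeffInt_natCast, h']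

theorem coeff_laurentSymbol_ne_zero (q : Kˣ) (J : Finset ℕ) {r : ℕ} {z : ℤ}
    (h : z + r = 0) : (laurentSymbol q J r).coeff z ≠ 0 := by
  rw [coeff_laurentSymbol, h, ← Nat.cast_zero, coeffInt_natCast, coeff_zero_eq_eval_zero,
    eval_prod]
  refine Finset.prod_ne_zero_iff.mpr fun j _ => ?_
  simp

theorem laurentEval_laurentSymbol_eq_zero (q : Kˣ) {J : Finset ℕ} (r : ℕ) {s : ℕ} (h : s ∈ J) :
    laurentEval q s (laurentSymbol q J r) = 0 := by
  rw [laurentEval_laurentSymbol, Finset.prod_eq_zero h (sub_self _), zero_mul]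

theorem laurentEval_laurentSymbol_ne_zero (q : Kˣ)
    (hq : Function.Injective fun k : ℤ => (q : K) ^ k) {J : Finset ℕ} (r : ℕ) {s : ℕ}
    (h : s ∉ J) : laurentEval q s (laurentSymbol q J r) ≠ 0 := by
  rw [laurentEval_laurentSymbol]
  refine mul_ne_zero (Finset.prod_ne_zero_iff.mpr fun j hj => sub_ne_zero.mpr fun hs => h ?_)
    (pow_ne_zero _ (inv_ne_zero (pow_ne_zero _ q.ne_zero)))
  have : (s : ℤ) = j := hq (by simpa using hs)
  rwa [Nat.cast_injective this]

end Symbols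

/-! ### Triangular families -/

section Triangular

/-- A family with a triangular dual family, with respect to some ranking, is linearly
independent. -/
theorem linearIndependent_of_triangular {K ι α M : Type*} [Field K] [AddCommGroup M] [Module K M]
    [LinearOrder α] (rank : ι → α) (v : ι → M) (f : ι → M →ₗ[K] K) (hne : ∀ i, f i (v i) ≠ 0)
    (hzero : ∀ i j, j ≠ i → rank j ≤ rank i → f i (v j) = 0) : LinearIndependent K v := by
  classical
  refine linearIndependent_iff'.mpr fun s c hc => ?_
  by_contra! hcon
  obtain ⟨i₀, hi₀, hci₀⟩ := hcon
  obtain ⟨i, hi, hmax⟩ := (s.filter fun i => c i ≠ 0).exists_max_image rank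
    ⟨i₀, Finset.mem_filter.mpr ⟨hi₀, hci₀⟩⟩
  rw [Finset.mem_filter] at hi
  have h := congrArg (f i) hc
  rw [map_sum, map_zero, Finset.sum_eq_single_of_mem i hi.1, map_smul] at h
  · exact (smul_ne_zero hi.2 (hne i)) h
  · intro j hj hji
    rw [map_smul]
    by_cases hcj : c j = 0
    · rw [hcj, zero_smul]
    · rw [hzero i j hji (hmax j (Finset.mem_filter.mpr ⟨hj, hcj⟩)), smul_zero]

end Triangular

/-! ### Labelling the monomials and computing their symbols -/

section Words

/-- The indices of the monomials in `𝒟` of degree `-m`. -/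
def IsIndex (m : ℤ) (i : ℕ × ℤ) : Prop := ¬(i.1 = 0 ∧ 0 ≤ i.2 ∧ i.2 < m)

/-- The monomial of degree `-m` whose leading term has degree `p` in `n` and is labelled by `k`. -/
def word (m : ℤ) (i : ℕ × ℤ) : FreeMonoid Letter :=
  if i.2 < 0 then
    xw ^ (i.1 + |i.2| - m).toNat * d₁w ^ (m - i.1 - |i.2|).toNat * dₘ₁w ^ i.2.natAbs * dw ^ i.1
  else if m < i.1 + i.2 ∨ i.1 = 0 then
    xw ^ (i.1 + i.2 - m).toNat * d₁w ^ i.2.natAbs * dw ^ i.1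
  else d₁w ^ (m - i.1 - i.2).toNat * dw * d₁w ^ i.2.natAbs * dw ^ (i.1 - 1)

theorem word_mem_monD (m : ℤ) (i : ℕ × ℤ) : word m i ∈ monD := by
  obtain ⟨p, k⟩ := i
  simp only [word]
  split_ifs with h1 h2
  · rcases Nat.eq_zero_or_pos (p + |k| - m).toNat with h | h
    · exact Or.inl (Or.inl (Or.inl ⟨_, _, _, by rw [h, pow_zero, one_mul]⟩))
    · have h' : (m - p - |k|).toNat = 0 := by omega
      exact Or.inr ⟨_, _, _, h, by rw [h', pow_zero, mul_one]⟩
  · rcases Nat.eq_zero_or_pos (p + k - m).toNat with h | h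
    · refine Or.inl (Or.inl (Or.inl ⟨k.natAbs, 0, p, ?_⟩))
      rw [h, pow_zero, one_mul, pow_zero, mul_one]
    · exact Or.inl (Or.inr ⟨_, _, _, h, rfl⟩)
  -- For `k = 0` the word `∂₁ʲ ∂ ∂₁ᵏ ∂ˡ` collapses to a standard monomial.
  · rcases Nat.eq_zero_or_pos k.natAbs with h | h
    · refine Or.inl (Or.inl (Or.inl ⟨(m - p - k).toNat, 0, p, ?_⟩))
      rw [h, pow_zero, mul_one, pow_zero, mul_one, mul_assoc, ← pow_succ', Nat.sub_add_cancel]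
      omega
    · exact Or.inl (Or.inl (Or.inr ⟨_, _, _, h, rfl⟩))

theorem exists_word_eq_of_mem_monG {w : FreeMonoid Letter} (hw : w ∈ monG) :
    ∃ (m : ℕ) (i : ℕ × ℤ), IsIndex m i ∧ (i.1 : ℤ) + |i.2| ≤ m ∧ w = word m i := by
  rcases hw with ⟨j, k, l, rfl⟩ | ⟨j, k, l, hk, rfl⟩
  -- Without `∂₋₁` the label is `(0, j)` if `l = 0` and `(l, 0)` otherwise.
  · rcases Nat.eq_zero_or_pos k with rfl | hk
    · rcases Nat.eq_zero_or_pos l with rfl | hl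
      · refine ⟨j, (0, j), ?_, by simp, ?_⟩
        · simp [IsIndex]
        · simp [word]
      · obtain ⟨l, rfl⟩ : ∃ l', l = l' + 1 := ⟨l - 1, by omega⟩
        refine ⟨j + (l + 1), (l + 1, 0), ?_, by simp, ?_⟩
        · simp [IsIndex]
        · simp only [word]
          have h : ¬ (((j + (l + 1) : ℕ) : ℤ) < ((l + 1 : ℕ) : ℤ) + 0 ∨ l + 1 = 0) := by omega
          rw [if_neg (lt_irrefl _), if_neg h]
          have : (((j + (l + 1) : ℕ) : ℤ) - ((l + 1 : ℕ) : ℤ) - 0).toNat = j := by omega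
          simp only [this, add_tsub_cancel_right, Int.natAbs_zero, pow_zero,
            mul_one, mul_assoc, ← pow_succ']
    · refine ⟨j + k + l, (l, -k), ?_, ?_, ?_⟩
      · simp only [IsIndex]
        omega
      · simp only [abs_neg, Nat.abs_cast]
        push_cast
        omega
      · simp only [word]
        rw [if_pos (by omega)]
        have h1 : ((l : ℤ) + |(-k : ℤ)| - ((j + k + l : ℕ) : ℤ)).toNat = 0 := by
          simp only [abs_neg, Nat.abs_cast]
          omega
        have h2 : (((j + k + l : ℕ) : ℤ) - l - |(-k : ℤ)|).toNat = j := by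
          simp only [abs_neg, Nat.abs_cast]
          omega
        rw [h1, h2]
        simp
  · refine ⟨j + k + l + 1, (l + 1, k), ?_, ?_, ?_⟩
    · simp [IsIndex]
    · simp only [Nat.abs_cast]
      push_cast
      omega
    · simp only [word]
      have h : ¬ (((j + k + l + 1 : ℕ) : ℤ) < ((l + 1 : ℕ) : ℤ) + (k : ℤ) ∨ l + 1 = 0) := by omega
      rw [if_neg (by omega), if_neg h]
      have h1 : (((j + k + l + 1 : ℕ) : ℤ) - ((l + 1 : ℕ) : ℤ) - k).toNat = j := by omega
      rw [h1]
      simp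

theorem exists_word_eq_of_mem_monD {w : FreeMonoid Letter} (hw : w ∈ monD) :
    ∃ (m : ℤ) (i : ℕ × ℤ), IsIndex m i ∧ w = word m i := by
  rcases hw with (hw | ⟨j, k, l, hj, rfl⟩) | ⟨j, k, l, hj, rfl⟩
  · obtain ⟨m, i, h, -, rfl⟩ := exists_word_eq_of_mem_monG hw
    exact ⟨m, i, h, rfl⟩
  · refine ⟨l + k - j, (l, k), ?_, ?_⟩
    · simp only [IsIndex]
      omega
    · simp only [word]
      rw [if_neg (by omega), if_pos (by omega)]
      simp
  · rcases Nat.eq_zero_or_pos k with rfl | hk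
    · refine ⟨l - j, (l, 0), ?_, ?_⟩
      · simp only [IsIndex]
        omega
      · simp only [word]
        rw [if_neg (by omega), if_pos (by omega)]
        simp
    · refine ⟨l + k - j, (l, -k), ?_, ?_⟩
      · simp only [IsIndex]
        omega
      · simp only [word]
        rw [if_pos (by omega)]
        have h2 : ((l : ℤ) + k - j - l - |(-k : ℤ)|).toNat = 0 := by
          simp only [abs_neg, Nat.abs_cast]
          omega
        rw [h2]
        simp

theorem word_mem_monG {m : ℤ} {i : ℕ × ℤ} (hi : IsIndex m i) (h : i.1 + |i.2| ≤ m) :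
    word m i ∈ monG := by
  obtain ⟨p, k⟩ := i
  simp only [IsIndex] at hi h
  have hk := le_abs_self k
  simp only [word]
  split_ifs with h1 h2
  · have h' : (p + |k| - m).toNat = 0 := by omega
    exact Or.inl ⟨_, _, _, by rw [h', pow_zero, one_mul]⟩
  · have h' : (p + k - m).toNat = 0 := by omega
    exact Or.inl ⟨k.natAbs, 0, p, by rw [h', pow_zero, one_mul, pow_zero, mul_one]⟩
  · rcases Nat.eq_zero_or_pos k.natAbs with h3 | h3
    · refine Or.inl ⟨(m - p - k).toNat, 0, p, ?_⟩
      rw [h3, pow_zero, mul_one, pow_zero, mul_one, mul_assoc, ← pow_succ', Nat.sub_add_cancel]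
      omega
    · exact Or.inr ⟨_, _, _, h3, rfl⟩

variable {K : Type*} [Field K]

theorem evalMon_xw (q : K) : evalMon q xw = LinearMap.mulLeft K X := FreeMonoid.lift_eval_of _ _

theorem evalMon_dw (q : K) : evalMon q dw = del q 0 := FreeMonoid.lift_eval_of _ _

theorem evalMon_d₁w (q : K) : evalMon q d₁w = del q 1 := FreeMonoid.lift_eval_of _ _

theorem evalMon_dₘ₁w (q : K) : evalMon q dₘ₁w = del q (-1) := FreeMonoid.lift_eval_of _ _

/-- The operator denoted by a monomial in `𝒟` is a power of `x` times an operator that lowers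
degrees, with known leading term. -/
theorem exists_lowers {q : K} (hq0 : q ≠ 0) (hq1 : q ≠ 1) {m : ℤ} {p : ℕ} {k : ℤ}
    (hi : IsIndex m (p, k)) : ∃ (a M : ℕ) (ψ : Module.End K K[X]) (I J : Finset ℕ) (r : ℕ),
      evalMon q (word m (p, k)) = LinearMap.mulLeft K X ^ a * ψ ∧ Lowers q ψ M I J r ∧
      (M : ℤ) = m + a ∧ (M : ℤ) ≤ max m (p + |k|) ∧ I.card = p ∧
      (k < 0 → (r : ℤ) = -k ∧ (J.card : ℤ) = -k + max (m - p + k) 0) ∧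
      (0 ≤ k → m < p + k ∨ p = 0 → r = 0 ∧ (J.card : ℤ) = k) ∧
      (0 ≤ k → p + k ≤ m → 0 < p → r = 0 ∧ (J.card : ℤ) = m - p ∧
        ∀ s : ℕ, p ≤ s + 1 → (s : ℤ) < m → (s ∈ J ↔ s + 1 ≠ p + k.toNat)) := by
  have h0 := lowers_one q
  simp only [IsIndex] at hi
  simp only [word]
  split_ifs with h1 h2
  -- Each `∂₋₁` contributes one factor `q ^ (-n)`, so `r = -k`. The `∂₁` present when `p + |k| < m`
  -- only enlarge `J`.
  · have h := ((h0.del_zero_pow_mul hq0 hq1 p).del_neg_one_pow_mul hq0 hq1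
      k.natAbs).del_one_pow_mul hq0 hq1 (m - p - |k|).toNat
    rw [abs_of_neg h1] at *
    refine ⟨(p + -k - m).toNat, _, _, _, _, _, ?_, h, by omega, by omega, by simp, fun _ => ⟨by omega, ?_⟩,
      fun _ => by omega, fun _ => by omega⟩
    · simp only [map_mul, map_pow, evalMon_xw, evalMon_dw, evalMon_d₁w, evalMon_dₘ₁w, mul_assoc,
        mul_one]
    · rw [Finset.empty_union, Finset.card_union_of_disjoint
        (Finset.Ico_disjoint_Ico_consecutive _ _ _), Nat.card_Ico, Nat.card_Ico]
      omega
  · have h := (h0.del_zero_pow_mul hq0 hq1 p).del_one_pow_mul hq0 hq1 k.natAbs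
    rw [abs_of_nonneg (by omega)]
    refine ⟨(p + k - m).toNat, _, _, _, _, _, ?_, h, by omega, by omega, by simp, fun _ => by omega,
      fun _ _ => ⟨rfl, ?_⟩, fun _ => by omega⟩
    · simp only [map_mul, map_pow, evalMon_xw, evalMon_dw, evalMon_d₁w, mul_assoc, mul_one]
    · rw [Finset.empty_union, Nat.card_Ico]
      omega
  -- The letters `∂` act at heights `0, …, p - 2` and `p - 1 + k`. The letters `∂₁` take the other
  -- heights below `m`, so `J` is `{p - 1, …, m - 1}` with the single gap `p - 1 + k`.
  · have h := (((h0.del_zero_pow_mul hq0 hq1 (p - 1)).del_one_pow_mul hq0 hq1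
      k.natAbs).del_zero_mul hq0 hq1).del_one_pow_mul hq0 hq1 (m - p - k).toNat
    rw [abs_of_nonneg (by omega)]
    refine ⟨0, _, _, _, _, _, ?_, h, by omega, by omega, ?_, fun _ => by omega,
      fun _ => by omega, fun _ _ _ => ⟨rfl, ?_, fun s hs hsm => ?_⟩⟩
    · simp only [map_mul, map_pow, evalMon_dw, evalMon_d₁w, mul_assoc, mul_one, pow_zero, one_mul]
    · rw [Finset.empty_union, Finset.card_union_of_disjoint (by simp), Nat.card_Ico,
        Finset.card_singleton]
      omega
    · rw [Finset.empty_union, Finset.card_union_of_disjoint, Nat.card_Ico, Nat.card_Ico]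
      · omega
      · refine Finset.disjoint_left.mpr fun s hs hs' => ?_
        rw [Finset.mem_Ico] at hs hs'
        omega
    · rw [Finset.empty_union, Finset.mem_union, Finset.mem_Ico, Finset.mem_Ico]
      omega

theorem comp_evalMon_word_of_ne {q : K} (hq0 : q ≠ 0) (hq1 : q ≠ 1) {m : ℤ} {i : ℕ × ℤ}
    (hi : IsIndex m i) {m' : ℤ} (hm : m' ≠ m) : comp m' (evalMon q (word m i)) = 0 := by
  obtain ⟨a, M, ψ, I, J, r, h, hψ, hM, -⟩ := exists_lowers hq0 hq1 hi
  rw [h, comp_X_pow_mul]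
  exact hψ.comp_of_ne _ (by omega)

theorem comp_evalMon_word_mem {q : K} (hq0 : q ≠ 0) (hq1 : q ≠ 1) {m : ℤ} {i : ℕ × ℤ}
    (hi : IsIndex m i) : comp m (evalMon q (word m i)) ∈ expPolyLE q (max m (i.1 + |i.2|)) := by
  obtain ⟨a, M, ψ, I, J, r, h, hψ, hM, hM', -⟩ := exists_lowers hq0 hq1 hi
  rw [h, comp_X_pow_mul, ← hM]
  exact expPolyLE_mono q hM' hψ.mem_expPolyLE

theorem exists_comp_evalMon_word (q : Kˣ) (hq1 : (q : K) ≠ 1) {m : ℤ} {p : ℕ} {k : ℤ}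
    (hi : IsIndex m (p, k)) : ∃ (I J : Finset ℕ) (r : ℕ) (c : K), c ≠ 0 ∧
      comp m (evalMon (q : K) (word m (p, k))) = symbolEval q (c • symbol q I J r) ∧ I.card = p ∧
      (k < 0 → (r : ℤ) = -k ∧ (J.card : ℤ) = -k + max (m - p + k) 0) ∧
      (0 ≤ k → m < p + k ∨ p = 0 → r = 0 ∧ (J.card : ℤ) = k) ∧
      (0 ≤ k → p + k ≤ m → 0 < p → r = 0 ∧ (J.card : ℤ) = m - p ∧
        ∀ s : ℕ, p ≤ s + 1 → (s : ℤ) < m → (s ∈ J ↔ s + 1 ≠ p + k.toNat)) := by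
  obtain ⟨a, M, ψ, I, J, r, h, hψ, hM, -, hrest⟩ := exists_lowers q.ne_zero hq1 hi
  obtain ⟨c, hc, hf⟩ := hψ.exists_comp
  refine ⟨I, J, r, c, hc, ?_, hrest⟩
  rw [h, comp_X_pow_mul, ← hM, map_smul, symbolEval_symbol]
  ext n
  exact hf n

end Words

/-! ### Linear independence of the monomials -/

section Independence

open scoped LaurentPolynomial

variable {K : Type*} [Field K]

/-- The coefficient of `T ^ k` as a linear map. -/
def laurentCoeff (k : ℤ) : K[T;T⁻¹] →ₗ[K] K where
  toFun L := L.coeff k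
  map_add' _ _ := rfl
  map_smul' _ _ := rfl

/-- The functional detecting the symbol labelled by `(p, k)` among those of degree `-m`. -/
def leadFunctional (q : Kˣ) (m : ℤ) (i : ℕ × ℤ) : K[T;T⁻¹][X] →ₗ[K] K :=
  (if 0 ≤ i.2 ∧ i.1 + i.2 ≤ m ∧ 0 < i.1 then laurentEvalLin q (i.1 - 1 + i.2.toNat)
    else laurentCoeff i.2) ∘ₗ (lcoeff K[T;T⁻¹] i.1).restrictScalars K

/-- The ranking for which the functionals `leadFunctional` are triangular. -/
def leadRank (m : ℤ) (i : ℕ × ℤ) : ℕ ×ₗ ℕ :=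
  toLex (i.1, if 0 ≤ i.2 ∧ i.1 + i.2 ≤ m ∧ 0 < i.1 then 0 else i.2.natAbs)

/-- In the Lagrange case the evaluation point is the unique gap of `J`. Otherwise the functional
reads the bottom coefficient of the Laurent polynomial if `k < 0` and the top one if `k ≥ 0`. -/
theorem leadFunctional_self_ne_zero (q : Kˣ) (hq : Function.Injective fun k : ℤ => (q : K) ^ k)
    (hq1 : (q : K) ≠ 1) {m : ℤ} {i : ℕ × ℤ} (hi : IsIndex m i) {F : K[T;T⁻¹][X]}
    (hF : comp m (evalMon (q : K) (word m i)) = symbolEval q F) [CharZero K] :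
    leadFunctional q m i F ≠ 0 := by
  obtain ⟨p, k⟩ := i
  obtain ⟨I, J, r, c, hc, h, rfl, hA, hB, hC⟩ := exists_comp_evalMon_word q hq1 hi
  rw [symbolEval_injective q hq (hF.symm.trans h), map_smul]
  refine smul_ne_zero hc ?_
  simp only [leadFunctional, LinearMap.comp_apply, LinearMap.restrictScalars_apply, lcoeff_apply,
    coeff_symbol_card]
  simp only [IsIndex] at hi
  split_ifs with h1
  · refine laurentEval_laurentSymbol_ne_zero q hq r fun hs => ?_
    exact ((hC h1.1 h1.2.1 h1.2.2).2.2 _ (by omega) (by omega)).mp hs (by omega)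
  · change (laurentSymbol q J r).coeff k ≠ 0
    rcases lt_or_ge k 0 with hk | hk
    · exact coeff_laurentSymbol_ne_zero q J (by have := hA hk; omega)
    · have := hB hk (by omega)
      rw [coeff_laurentSymbol_card q (by omega)]
      exact one_ne_zero

theorem leadFunctional_eq_zero (q : Kˣ) (hq : Function.Injective fun k : ℤ => (q : K) ^ k)
    (hq1 : (q : K) ≠ 1) {m : ℤ} {i j : ℕ × ℤ} (hi : IsIndex m i) (hj : IsIndex m j)
    (hji : j ≠ i) (hrank : leadRank m j ≤ leadRank m i) {F : K[T;T⁻¹][X]}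
    (hF : comp m (evalMon (q : K) (word m j)) = symbolEval q F) [CharZero K] :
    leadFunctional q m i F = 0 := by
  obtain ⟨p, k⟩ := i
  obtain ⟨p', k'⟩ := j
  obtain ⟨I, J, r, c, hc, h, rfl, hA, hB, hC⟩ := exists_comp_evalMon_word q hq1 hj
  rw [symbolEval_injective q hq (hF.symm.trans h), map_smul]
  rw [leadRank, leadRank, Prod.Lex.toLex_le_toLex] at hrank
  simp only [leadFunctional, LinearMap.comp_apply, LinearMap.restrictScalars_apply, lcoeff_apply]
  rcases hrank with hp | ⟨hp, hrank⟩
  · simp only at hp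
    rw [coeff_symbol_of_lt q J r hp, map_zero, smul_zero]
  · simp only at hp hrank
    subst hp
    have hk : k' ≠ k := fun hk => hji (by rw [hk])
    rw [coeff_symbol_card]
    simp only [IsIndex] at hi hj
    suffices h0 : (if 0 ≤ k ∧ (I.card : ℤ) + k ≤ m ∧ 0 < I.card then
        laurentEvalLin q (I.card - 1 + k.toNat) else laurentCoeff k) (laurentSymbol q J r) = 0 by
      rw [h0, smul_zero]
    -- Two Lagrange labels: the gap of one lies in the `J` of the other. Only `i` Lagrange: the
    -- ranking forces `k' = 0`, and then `j` would be Lagrange too. Only `j` Lagrange: its exponents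
    -- lie in `[0, m - p]`, which misses `k`. Neither: since `|k'| ≤ |k|` and `k' ≠ k`, the exponent
    -- `k` falls outside the support.
    by_cases h1 : 0 ≤ k ∧ (I.card : ℤ) + k ≤ m ∧ 0 < I.card <;>
      by_cases h2 : 0 ≤ k' ∧ (I.card : ℤ) + k' ≤ m ∧ 0 < I.card
    · rw [if_pos h1]
      refine laurentEval_laurentSymbol_eq_zero q r ?_
      exact ((hC h2.1 h2.2.1 h2.2.2).2.2 _ (by omega) (by omega)).mpr (by omega)
    · rw [if_pos h1, if_neg h2] at hrank
      omega
    · rw [if_neg h1]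
      change (laurentSymbol q J r).coeff k = 0
      have := hC h2.1 h2.2.1 h2.2.2
      rcases lt_or_ge k 0 with hk0 | hk0
      · exact coeff_laurentSymbol_of_lt q J (by omega)
      · exact coeff_laurentSymbol_of_gt q (by omega)
    · rw [if_neg h1, if_neg h2] at hrank
      rw [if_neg h1]
      change (laurentSymbol q J r).coeff k = 0
      rcases lt_or_ge k' 0 with hk' | hk'
      · have := hA hk'
        rcases lt_or_ge k 0 with hk0 | hk0
        · exact coeff_laurentSymbol_of_lt q J (by omega)
        · exact coeff_laurentSymbol_of_gt q (by omega)
      · have := hB hk' (by omega)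
        rcases lt_or_ge k 0 with hk0 | hk0
        · exact coeff_laurentSymbol_of_lt q J (by omega)
        · exact coeff_laurentSymbol_of_gt q (by omega)

/-- The operators denoted by the monomials in `𝒟` are linearly independent. -/
theorem linearIndependent_evalMon_word [CharZero K] (q : Kˣ)
    (hq : Function.Injective fun k : ℤ => (q : K) ^ k) (hq1 : (q : K) ≠ 1) :
    LinearIndependent K (fun x : {x : ℤ × ℕ × ℤ // IsIndex x.1 x.2} =>
      evalMon (q : K) (word x.1.1 x.1.2)) := by
  -- A linear left inverse recovers the symbol from the sequence, which turns the functionals on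
  -- symbols into functionals on operators.
  obtain ⟨g, hg⟩ := LinearMap.exists_leftInverse_of_injective (symbolEval q)
    (LinearMap.ker_eq_bot.mpr (symbolEval_injective q hq))
  have hsym : ∀ {m i}, IsIndex m i → comp m (evalMon (q : K) (word m i)) =
      symbolEval q (g (comp m (evalMon (q : K) (word m i)))) := by
    rintro m ⟨p, k⟩ hi
    obtain ⟨I, J, r, c, -, h, -⟩ := exists_comp_evalMon_word q hq1 hi
    rw [h, ← LinearMap.comp_apply g, hg, LinearMap.id_apply]
  refine linearIndependent_of_triangular (fun x => leadRank x.1.1 x.1.2) _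
    (fun x => leadFunctional q x.1.1 x.1.2 ∘ₗ g ∘ₗ comp x.1.1) ?_ ?_
  · rintro ⟨⟨m, i⟩, hi⟩
    exact leadFunctional_self_ne_zero q hq hq1 hi (hsym hi)
  · rintro ⟨⟨m, i⟩, hi⟩ ⟨⟨m', j⟩, hj⟩ hne hrank
    simp only [LinearMap.comp_apply]
    by_cases hm : m = m'
    · subst hm
      exact leadFunctional_eq_zero q hq hq1 hi hj (fun h => hne (by simp only at h; subst h; rfl))
        hrank (hsym hj)
    · simp only at hj
      rw [comp_evalMon_word_of_ne q.ne_zero hq1 hj hm, map_zero, map_zero]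

end Independence

/-! ### Counting labels and bounding dimensions -/

section Spanning

/-- The pairs `(p, k)` with `p + |k| ≤ N`. -/
def indexBall (N : ℕ) : Finset (ℕ × ℤ) :=
  ((Finset.range (N + 1)).sigma fun p => Finset.Icc (-((N - p : ℕ) : ℤ)) ((N - p : ℕ) : ℤ)).map
    (Equiv.sigmaEquivProd ℕ ℤ).toEmbedding

theorem mem_indexBall {N : ℕ} {i : ℕ × ℤ} : i ∈ indexBall N ↔ (i.1 : ℤ) + |i.2| ≤ N := by
  obtain ⟨p, k⟩ := i
  simp only [indexBall, Finset.mem_map_equiv, Equiv.sigmaEquivProd_symm_apply, Finset.mem_sigma,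
    Finset.mem_range, Finset.mem_Icc]
  rcases abs_cases k with ⟨h, _⟩ | ⟨h, _⟩ <;> omega

theorem card_indexBall (N : ℕ) : (indexBall N).card = (N + 1) ^ 2 := by
  rw [indexBall, Finset.card_map, Finset.card_sigma]
  simp only [Int.card_Icc]
  have : ∀ p ∈ Finset.range (N + 1),
      (((N - p : ℕ) : ℤ) + 1 - -((N - p : ℕ) : ℤ)).toNat = 2 * (N - p) + 1 := fun p _ => by omega
  rw [Finset.sum_congr rfl this, ← Finset.sum_range_reflect]
  have : ∀ p ∈ Finset.range (N + 1), 2 * (N - (N + 1 - 1 - p)) + 1 = 2 * p + 1 := fun p hp => by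
    rw [Finset.mem_range] at hp
    omega
  rw [Finset.sum_congr rfl this]
  induction N + 1 with
  | zero => rfl
  | succ n ih => rw [Finset.sum_range_succ, ih]; ring

open Classical in
/-- The indices `(p, k)` of monomials of degree `-m` with `p + |k| ≤ N`. -/
def indexSet (m : ℤ) (N : ℕ) : Finset (ℕ × ℤ) := (indexBall N).filter (IsIndex m)

theorem mem_indexSet {m : ℤ} {N : ℕ} {i : ℕ × ℤ} :
    i ∈ indexSet m N ↔ (i.1 : ℤ) + |i.2| ≤ N ∧ IsIndex m i := by
  classical
  rw [indexSet, Finset.mem_filter, mem_indexBall]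

theorem card_indexSet {m : ℤ} {N : ℕ} (h : m ≤ N) :
    (indexSet m N).card + m.toNat = (N + 1) ^ 2 := by
  classical
  rw [← card_indexBall, ← Finset.card_filter_add_card_filter_not (s := indexBall N) (IsIndex m),
    indexSet]
  congr 1
  -- The excluded labels are `(0, k)` with `0 ≤ k < m`. They all lie in the ball because `m ≤ N`.
  have : (indexBall N).filter (fun i => ¬ IsIndex m i) =
      (Finset.range m.toNat).map ⟨fun k : ℕ => ((0 : ℕ), (k : ℤ)),
        fun a b hab => by simpa using hab⟩ := by
    ext ⟨p, k⟩
    rw [Finset.mem_filter, mem_indexBall, IsIndex, not_not, Finset.mem_map]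
    constructor
    · rintro ⟨-, hp, hk, hkm⟩
      simp only at hp hk hkm
      exact ⟨k.toNat, Finset.mem_range.mpr (by omega),
        Prod.ext hp.symm (Int.toNat_of_nonneg hk)⟩
    · rintro ⟨k', hk, h⟩
      obtain ⟨rfl, rfl⟩ := Prod.mk.inj h
      rw [Finset.mem_range] at hk
      refine ⟨?_, rfl, by simp, ?_⟩
      · simp only [Nat.abs_cast]
        omega
      · simp only
        omega
  rw [this, Finset.card_map, Finset.card_range]

variable {K : Type*} [Field K]

/-- The sequences in `expPolyLE q N` that vanish at the first `n` natural numbers. -/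
def expPolyVanishing (q : K) (n N : ℕ) : Submodule K (ℕ → K) :=
  expPolyLE q N ⊓ LinearMap.ker (LinearMap.funLeft K K (fun i : Fin n => (i : ℕ)))

theorem mem_expPolyVanishing {q : K} {n N : ℕ} {f : ℕ → K} :
    f ∈ expPolyVanishing q n N ↔ f ∈ expPolyLE q N ∧ ∀ i < n, f i = 0 := by
  refine and_congr_right fun _ => ?_
  rw [SetLike.mem_coe, LinearMap.mem_ker, funext_iff]
  exact ⟨fun h i hi => h ⟨i, hi⟩, fun h i => h i i.2⟩

theorem expPolyLE_eq_span_image (q : K) (N : ℕ) :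
    expPolyLE q N = Submodule.span K (expPoly q '' (indexBall N : Set (ℕ × ℤ))) := by
  rw [expPolyLE]
  congr 2
  ext i
  exact mem_indexBall.symm

instance (q : K) (N : ℕ) : FiniteDimensional K (expPolyLE q N) := by
  rw [expPolyLE_eq_span_image]
  exact FiniteDimensional.span_of_finite K ((Finset.finite_toSet _).image _)

theorem finrank_expPolyLE_le (q : K) (N : ℕ) : Module.finrank K (expPolyLE q N) ≤ (N + 1) ^ 2 := by
  classical
  rw [expPolyLE_eq_span_image, ← Finset.coe_image]
  exact (finrank_span_finset_le_card _).trans (Finset.card_image_le.trans (card_indexBall N).le)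

theorem polynomial_eval_mem_expPolyLE (q : K) {P : K[X]} {N : ℕ} (h : P.natDegree ≤ N) :
    (fun n : ℕ => P.eval (n : K)) ∈ expPolyLE q N := by
  have : (fun n : ℕ => P.eval (n : K)) =
      ∑ i ∈ Finset.range (N + 1), P.coeff i • expPoly q (i, 0) := by
    ext n
    rw [eval_eq_sum_range' (Nat.lt_succ_of_le h)]
    simp [expPoly]
  rw [this]
  refine Submodule.sum_mem _ fun i hi => Submodule.smul_mem _ _ (expPoly_mem_expPolyLE q ?_)
  rw [Finset.mem_range] at hi
  simp only [abs_zero]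
  omega

/-- Evaluation at `0, …, n - 1` is already onto when restricted to polynomials in the index of
degree at most `N`, by Lagrange interpolation. Rank–nullity then gives the bound. -/
theorem finrank_expPolyVanishing_add_le [CharZero K] (q : K) {n N : ℕ} (h : n ≤ N) :
    Module.finrank K (expPolyVanishing q n N) + n ≤ (N + 1) ^ 2 := by
  let ρ : (ℕ → K) →ₗ[K] (Fin n → K) := LinearMap.funLeft K K (fun i : Fin n => (i : ℕ))
  have hrange : LinearMap.range (ρ.domRestrict (expPolyLE q N)) = ⊤ := by
    refine LinearMap.range_eq_top.mpr fun y => ?_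
    have hinj : Set.InjOn (fun i : Fin n => ((i : ℕ) : K)) (Finset.univ : Finset (Fin n)) :=
      fun a _ b _ hab => Fin.ext (Nat.cast_injective hab)
    have hdeg := Lagrange.degree_interpolate_lt y hinj
    rw [Finset.card_univ, Fintype.card_fin] at hdeg
    refine ⟨⟨_, polynomial_eval_mem_expPolyLE q (P := Lagrange.interpolate Finset.univ
      (fun i : Fin n => ((i : ℕ) : K)) y) ?_⟩, ?_⟩
    · exact natDegree_le_of_degree_le (hdeg.le.trans (by exact_mod_cast h))
    · ext i
      exact Lagrange.eval_interpolate_at_node y hinj (Finset.mem_univ i)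
  have hker : Module.finrank K (LinearMap.ker (ρ.domRestrict (expPolyLE q N))) =
      Module.finrank K (expPolyVanishing q n N) := by
    have : expPolyVanishing q n N =
        (LinearMap.ker (ρ.domRestrict (expPolyLE q N))).map (expPolyLE q N).subtype := by
      rw [LinearMap.ker_domRestrict, Submodule.map_comap_subtype]
      rfl
    rw [this]
    exact (Submodule.finrank_map_subtype_eq _ _).symm
  have hrn := LinearMap.finrank_range_add_finrank_ker (ρ.domRestrict (expPolyLE q N))
  rw [hrange, finrank_top, Module.finrank_fin_fun, hker] at hrn
  have := finrank_expPolyLE_le q N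
  omega

end Spanning

/-! ### The bases of $G$ and $D$ -/

section Bases

variable {K : Type*} [Field K] (q : Kˣ)

theorem ne_one_of_zpow_injective (hq : Function.Injective fun k : ℤ => (q : K) ^ k) :
    (q : K) ≠ 1 := fun h => by
  have : (0 : ℤ) = 1 := hq (by simp [h])
  omega

theorem linearIndependent_evalMon_indexSet [CharZero K] (hq1 : (q : K) ≠ 1)
    (hq : Function.Injective fun k : ℤ => (q : K) ^ k) (m : ℤ) (N : ℕ) :
    LinearIndependent K (fun i : indexSet m N => evalMon (q : K) (word m i)) :=
  (linearIndependent_evalMon_word q hq hq1).comp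
    (fun i : indexSet m N => ⟨(m, (i : ℕ × ℤ)), (mem_indexSet.mp i.2).2⟩)
    fun _ _ h => Subtype.ext (Prod.mk.inj (Subtype.mk.inj h)).2

/-- The span of the operators denoted by the monomials indexed by `indexSet m N`. -/
def indexSpan (q : K) (m : ℤ) (N : ℕ) : Submodule K (Module.End K K[X]) :=
  Submodule.span K (Set.range fun i : indexSet m N => evalMon q (word m i))

theorem finrank_indexSpan [CharZero K] (hq1 : (q : K) ≠ 1)
    (hq : Function.Injective fun k : ℤ => (q : K) ^ k) (m : ℤ) (N : ℕ) :
    Module.finrank K (indexSpan (q : K) m N) = (indexSet m N).card := by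
  rw [indexSpan, finrank_span_eq_card (linearIndependent_evalMon_indexSet q hq1 hq m N),
    Fintype.card_coe]

/-- One inclusion comes from the bounds on the components of the monomials. Equality holds because
the number of independent monomials reaches the upper bound for the dimension on the right. -/
theorem indexSpan_eq_map [CharZero K] (hq1 : (q : K) ≠ 1)
    (hq : Function.Injective fun k : ℤ => (q : K) ^ k) {m : ℤ} {N : ℕ} (h : m ≤ N) :
    indexSpan (q : K) m N = (expPolyVanishing (q : K) m.toNat N).map (shiftOp m) := by
  have hfin : FiniteDimensional K (expPolyVanishing (q : K) m.toNat N) :=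
    Submodule.finiteDimensional_inf_left _ _
  refine Submodule.eq_of_le_of_finrank_le (Submodule.span_le.mpr ?_) ?_
  · rintro _ ⟨⟨i, hi⟩, rfl⟩
    obtain ⟨hiN, hi⟩ := mem_indexSet.mp hi
    refine ⟨comp m (evalMon (q : K) (word m i)), mem_expPolyVanishing.mpr ⟨?_, fun n hn => ?_⟩, ?_⟩
    · exact expPolyLE_mono _ (max_le h hiN) (comp_evalMon_word_mem q.ne_zero hq1 hi)
    · exact comp_of_lt _ (by omega)
    · exact shiftOp_comp fun m' hm' => comp_evalMon_word_of_ne q.ne_zero hq1 hi hm'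
  · rw [finrank_indexSpan q hq1 hq]
    have h1 := Submodule.finrank_map_le (shiftOp m) (expPolyVanishing (q : K) m.toNat N)
    have h2 := finrank_expPolyVanishing_add_le (q : K) (Int.toNat_le.mpr h)
    have h3 := card_indexSet h
    omega

theorem shiftOp_mem_indexSpan [CharZero K] (hq1 : (q : K) ≠ 1)
    (hq : Function.Injective fun k : ℤ => (q : K) ^ k) {m : ℤ} {N : ℕ} (h : m ≤ N) {f : ℕ → K}
    (hf : f ∈ expPolyLE (q : K) N) (hf0 : ∀ n : ℕ, (n : ℤ) < m → f n = 0) :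
    shiftOp m f ∈ indexSpan (q : K) m N := by
  rw [indexSpan_eq_map q hq1 hq h]
  exact Submodule.mem_map_of_mem (mem_expPolyVanishing.mpr ⟨hf, fun n hn => hf0 n (by omega)⟩)

theorem indexSpan_le_span_monD (q : K) (m : ℤ) (N : ℕ) :
    indexSpan q m N ≤ Submodule.span K ((fun w => evalMon q w) '' monD) := by
  refine Submodule.span_mono ?_
  rintro _ ⟨i, rfl⟩
  exact ⟨_, word_mem_monD m i, rfl⟩

theorem indexSpan_le_span_monG (q : K) (m : ℕ) :
    indexSpan q m m ≤ Submodule.span K ((fun w => evalMon q w) '' monG) := by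
  refine Submodule.span_mono ?_
  rintro _ ⟨⟨i, hi⟩, rfl⟩
  obtain ⟨h1, h2⟩ := mem_indexSet.mp hi
  exact ⟨_, word_mem_monG h2 h1, rfl⟩

theorem span_monD [CharZero K] (hq1 : (q : K) ≠ 1) (hq : Function.Injective fun k : ℤ => (q : K) ^ k) :
    Submodule.span K ((fun w => evalMon (q : K) w) '' monD) = DqPoly (q : K) := by
  refine le_antisymm (Submodule.span_le.mpr ?_)
    ((DqPoly_le_finiteComps q.ne_zero hq).trans (finiteComps_le fun m f hf hf0 => ?_))
  · rintro _ ⟨w, hw, rfl⟩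
    obtain ⟨m, i, hi, rfl⟩ := exists_word_eq_of_mem_monD hw
    exact mem_DqPoly_of_annihilated (fun m' hm' => comp_evalMon_word_of_ne q.ne_zero hq1 hi hm')
      (expPolys_le_annihilated _ (expPolyLE_le_expPolys _ _
        (comp_evalMon_word_mem q.ne_zero hq1 hi)))
  · obtain ⟨N, hN, hf⟩ := exists_mem_expPolyLE hf (max m 0)
    lift N to ℕ using (le_max_right _ _).trans hN
    exact indexSpan_le_span_monD _ _ _
      (shiftOp_mem_indexSpan q hq1 hq ((le_max_left _ _).trans hN) hf hf0)

theorem linearIndepOn_monD [CharZero K] (hq1 : (q : K) ≠ 1)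
    (hq : Function.Injective fun k : ℤ => (q : K) ^ k) :
    LinearIndepOn K (fun w => evalMon (q : K) w) monD := by
  have h := linearIndependent_evalMon_word q hq hq1
  -- Distinct labels give distinct operators by independence, hence distinct words.
  have hinj : Function.Injective fun x : {x : ℤ × ℕ × ℤ // IsIndex x.1 x.2} =>
      word x.1.1 x.1.2 := fun x y hxy => h.injective (congrArg (evalMon (q : K)) hxy)
  have h' : LinearIndepOn K (fun w => evalMon (q : K) w)
      (Set.range fun x : {x : ℤ × ℕ × ℤ // IsIndex x.1 x.2} => word x.1.1 x.1.2) :=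
    (linearIndepOn_range_iff hinj _).mpr h
  refine h'.mono fun w hw => ?_
  obtain ⟨m, i, hi, rfl⟩ := exists_word_eq_of_mem_monD hw
  exact ⟨⟨(m, i), hi⟩, rfl⟩

theorem exists_lowers_of_mem_closure {q : K} (hq0 : q ≠ 0) (hq1 : q ≠ 1)
    {φ : Module.End K K[X]} (h : φ ∈ Submonoid.closure {del q 0, del q 1, del q (-1)}) :
    ∃ M I J r, Lowers q φ M I J r := by
  induction h using Submonoid.closure_induction_left with
  | one => exact ⟨_, _, _, _, lowers_one q⟩
  | mul_left x hx y _ hy =>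
    obtain ⟨M, I, J, r, hy⟩ := hy
    rcases hx with rfl | rfl | rfl
    · exact ⟨_, _, _, _, hy.del_zero_mul hq0 hq1⟩
    · exact ⟨_, _, _, _, hy.del_one_mul hq0 hq1⟩
    · exact ⟨_, _, _, _, hy.del_neg_one_mul hq0 hq1⟩

theorem G_le_finiteComps {q : K} (hq0 : q ≠ 0) (hq1 : q ≠ 1) :
    Subalgebra.toSubmodule (G q) ≤ finiteComps (expPolyLE q) := by
  rw [G, Algebra.adjoin_eq_span]
  refine Submodule.span_le.mpr fun φ hφ => ?_
  obtain ⟨M, I, J, r, h⟩ := exists_lowers_of_mem_closure hq0 hq1 hφ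
  exact mem_finiteComps_of_homogeneous h.comp_of_ne h.mem_expPolyLE

theorem expPolyLE_of_neg (q : K) {m : ℤ} (h : m < 0) : expPolyLE q m = ⊥ := by
  have : {i : ℕ × ℤ | (i.1 : ℤ) + |i.2| ≤ m} = ∅ := by
    ext i
    have := abs_nonneg i.2
    simp only [Set.mem_ofPred_eq, Set.mem_empty_iff_false, iff_false]
    omega
  rw [expPolyLE, this, Set.image_empty, Submodule.span_empty]

theorem span_monG [CharZero K] (hq1 : (q : K) ≠ 1) (hq : Function.Injective fun k : ℤ => (q : K) ^ k) :
    Submodule.span K ((fun w => evalMon (q : K) w) '' monG) =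
      Subalgebra.toSubmodule (G (q : K)) := by
  have h0 : del (q : K) 0 ∈ G (q : K) := Algebra.subset_adjoin (by simp)
  have h1 : del (q : K) 1 ∈ G (q : K) := Algebra.subset_adjoin (by simp)
  have h2 : del (q : K) (-1) ∈ G (q : K) := Algebra.subset_adjoin (by simp)
  refine le_antisymm (Submodule.span_le.mpr ?_)
    ((G_le_finiteComps q.ne_zero hq1).trans (finiteComps_le fun m f hf hf0 => ?_))
  · rintro _ ⟨w, ⟨j, k, l, rfl⟩ | ⟨j, k, l, -, rfl⟩, rfl⟩
    · simp only [map_mul, map_pow, evalMon_dw, evalMon_d₁w, evalMon_dₘ₁w]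
      exact (G (q : K)).mul_mem ((G (q : K)).mul_mem (pow_mem h1 _) (pow_mem h2 _)) (pow_mem h0 _)
    · simp only [map_mul, map_pow, evalMon_dw, evalMon_d₁w]
      exact (G (q : K)).mul_mem ((G (q : K)).mul_mem ((G (q : K)).mul_mem (pow_mem h1 _) h0) (pow_mem h1 _)) (pow_mem h0 _)
  · rcases lt_or_ge m 0 with hm | hm
    · rw [expPolyLE_of_neg _ hm, Submodule.mem_bot] at hf
      rw [hf, map_zero]
      exact Submodule.zero_mem _
    · lift m to ℕ using hm
      exact indexSpan_le_span_monG _ _ (shiftOp_mem_indexSpan q hq1 hq le_rfl hf hf0)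

theorem Gcomp_eq_indexSpan [CharZero K] (hq1 : (q : K) ≠ 1)
    (hq : Function.Injective fun k : ℤ => (q : K) ^ k) (n : ℕ) :
    Gcomp (q : K) n = indexSpan (q : K) n n := by
  refine le_antisymm ?_ (le_inf ?_ (Submodule.span_le.mpr ?_))
  · rintro φ ⟨hG, hφ⟩
    have hφ' : ∀ m ≠ (n : ℤ), comp m φ = 0 := by
      simpa using mem_homogeneousEnd.mp hφ
    rw [← shiftOp_comp hφ']
    exact shiftOp_mem_indexSpan q hq1 hq le_rfl ((G_le_finiteComps q.ne_zero hq1 hG).1 n)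
      fun _ hn => comp_of_lt _ hn
  · exact (indexSpan_le_span_monG _ _).trans (span_monG q hq1 hq).le
  · rintro _ ⟨⟨i, hi⟩, rfl⟩
    refine mem_homogeneousEnd.mpr fun m hm => ?_
    rw [neg_neg] at hm
    exact comp_evalMon_word_of_ne q.ne_zero hq1 (mem_indexSet.mp hi).2 hm

theorem finrank_Gcomp [CharZero K] (hq1 : (q : K) ≠ 1) (hq : Function.Injective fun k : ℤ => (q : K) ^ k)
    (n : ℕ) : Module.finrank K (Gcomp (q : K) n) = n ^ 2 + n + 1 := by
  rw [Gcomp_eq_indexSpan q hq1 hq, finrank_indexSpan q hq1 hq]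
  have := card_indexSet (le_refl (n : ℤ))
  rw [Int.toNat_natCast] at this
  have h2 : (n + 1) ^ 2 = n ^ 2 + n + 1 + n := by ring
  omega

theorem rank_Gcomp [CharZero K] (hq1 : (q : K) ≠ 1) (hq : Function.Injective fun k : ℤ => (q : K) ^ k)
    (n : ℕ) : Module.rank K (Gcomp (q : K) n) = ((n ^ 2 + n + 1 : ℕ) : Cardinal) := by
  rw [← finrank_Gcomp q hq1 hq n]
  have : FiniteDimensional K (Gcomp (q : K) n) := by
    rw [Gcomp_eq_indexSpan q hq1 hq]
    exact FiniteDimensional.span_of_finite K (Set.finite_range _)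
  exact (Module.finrank_eq_rank K _).symm

end Bases

/-- The series with coefficients `n ^ 2 + n + 1` is `(1 + t ^ 2) / (1 - t) ^ 3`. -/
theorem hilbertSeries_eq :
    PowerSeries.mk (fun n : ℕ => ((n ^ 2 + n + 1 : ℕ) : ℤ)) * (1 - PowerSeries.X) ^ 3 =
      1 + PowerSeries.X ^ 2 := by
  -- Multiplication by `1 - t` takes successive differences of the coefficients.
  have h1 : PowerSeries.mk (fun n : ℕ => ((n ^ 2 + n + 1 : ℕ) : ℤ)) * (1 - PowerSeries.X) =
      1 + PowerSeries.mk (fun n : ℕ => (2 * n : ℤ)) := by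
    ext n
    rw [mul_sub, mul_one, map_sub, map_add, PowerSeries.coeff_mk, PowerSeries.coeff_mk,
      PowerSeries.coeff_one]
    rcases n with _ | n
    · simp
    · rw [PowerSeries.coeff_succ_mul_X, PowerSeries.coeff_mk, if_neg (Nat.succ_ne_zero n)]
      push_cast
      ring
  have h2 : PowerSeries.mk (fun n : ℕ => (2 * n : ℤ)) * (1 - PowerSeries.X) =
      PowerSeries.X * PowerSeries.mk (fun _ : ℕ => (2 : ℤ)) := by
    ext n
    rw [mul_sub, mul_one, map_sub, PowerSeries.coeff_mk]
    rcases n with _ | n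
    · simp
    · rw [PowerSeries.coeff_succ_mul_X, PowerSeries.coeff_succ_X_mul, PowerSeries.coeff_mk,
        PowerSeries.coeff_mk]
      push_cast
      ring
  have h3 : PowerSeries.mk (fun _ : ℕ => (2 : ℤ)) * (1 - PowerSeries.X) = 2 := by
    ext n
    rw [mul_sub, mul_one, map_sub, PowerSeries.coeff_mk,
      show (2 : PowerSeries ℤ) = PowerSeries.C 2 from rfl, PowerSeries.coeff_C]
    rcases n with _ | n
    · simp
    · rw [PowerSeries.coeff_succ_mul_X, PowerSeries.coeff_mk]
      simp
  calc _ = (PowerSeries.mk (fun n : ℕ => ((n ^ 2 + n + 1 : ℕ) : ℤ)) * (1 - PowerSeries.X)) *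
        (1 - PowerSeries.X) ^ 2 := by ring
    _ = (1 - PowerSeries.X) ^ 2 + (PowerSeries.mk (fun n : ℕ => (2 * n : ℤ)) *
        (1 - PowerSeries.X)) * (1 - PowerSeries.X) := by rw [h1]; ring
    _ = (1 - PowerSeries.X) ^ 2 + PowerSeries.X * (PowerSeries.mk (fun _ : ℕ => (2 : ℤ)) *
        (1 - PowerSeries.X)) := by rw [h2]; ring
    _ = _ := by rw [h3]; ring

/-! ### The Gelfand–Kirillov dimension of $G$ -/

section GKDimension

variable {K : Type*} [Field K]

/-- The span of the generators of `G`. -/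
def genSpan (q : K) : Submodule K (Module.End K K[X]) :=
  Submodule.span K {del q 0, del q 1, del q (-1)}

/-- The operators with components of degrees `-n, …, 0` only, the coefficient function of the
component of degree `-m` being in `expPolyLE q m`. -/
def boundedOps (q : K) (n : ℕ) : Submodule K (Module.End K K[X]) :=
  finiteComps fun m => if m ≤ n then expPolyLE q m else ⊥

theorem boundedOps_mono (q : K) {n n' : ℕ} (h : n ≤ n') : boundedOps q n ≤ boundedOps q n' := by
  rintro φ ⟨h1, h2⟩
  refine ⟨fun m => ?_, h2⟩
  have := h1 m
  simp only at this ⊢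
  split_ifs at this ⊢
  · exact this
  · exact (Submodule.mem_bot K).mp this ▸ Submodule.zero_mem _
  · omega
  · exact this

theorem genSpan_mul_boundedOps_le {q : K} (hq0 : q ≠ 0) (hq1 : q ≠ 1) (n : ℕ) :
    genSpan q * boundedOps q n ≤ boundedOps q (n + 1) := by
  have key : ∀ a : ℤ, |a| ≤ 1 → ∀ φ ∈ boundedOps q n, del q a * φ ∈ boundedOps q (n + 1) := by
    rintro a ha φ ⟨h1, h2⟩
    refine ⟨fun m => ?_, (h2.preimage (f := fun m : ℤ => m - 1)
      (sub_left_injective (b := (1 : ℤ))).injOn).subset fun m hm h => hm (comp_del_mul_of_ne h)⟩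
    have := h1 (m - 1)
    simp only at this ⊢
    split_ifs at this ⊢
    · have h := comp_del_mul_mem_expPolyLE hq0 hq1 ha this
      rwa [sub_add_cancel] at h
    · push_cast at *
      omega
    · push_cast at *
      omega
    · exact (Submodule.mem_bot K).mpr (comp_del_mul_of_ne ((Submodule.mem_bot K).mp this))
  refine Submodule.mul_le.mpr fun ψ hψ φ hφ => ?_
  induction hψ using Submodule.span_induction with
  | mem ψ hψ =>
    rcases hψ with rfl | rfl | rfl <;> exact key _ (by simp) φ hφ
  | zero => rw [zero_mul]; exact Submodule.zero_mem _
  | add x y _ _ hx hy => rw [add_mul]; exact Submodule.add_mem _ hx hy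
  | smul c x _ hx => rw [smul_mul_assoc]; exact Submodule.smul_mem _ _ hx

theorem one_sup_genSpan_pow_le {q : K} (hq0 : q ≠ 0) (hq1 : q ≠ 1) (n : ℕ) :
    (1 ⊔ genSpan q) ^ n ≤ boundedOps q n := by
  induction n with
  | zero =>
    rw [pow_zero, Submodule.one_eq_span, Submodule.span_singleton_le_iff_mem]
    have h := lowers_one q
    refine mem_finiteComps_of_homogeneous h.comp_of_ne ?_
    rw [if_pos le_rfl]
    exact h.mem_expPolyLE
  | succ n ih =>
    rw [pow_succ', Submodule.sup_mul, one_mul]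
    exact sup_le (ih.trans (boundedOps_mono q n.le_succ))
      ((mul_le_mul' le_rfl ih).trans (genSpan_mul_boundedOps_le hq0 hq1 n))

theorem finrank_boundedOps_le (q : K) (n : ℕ) :
    FiniteDimensional K (boundedOps q n) ∧
      Module.finrank K (boundedOps q n) ≤ (n + 1) ^ 3 := by
  let L : boundedOps q n →ₗ[K] ((m : Fin (n + 1)) → expPolyLE q (m : ℕ)) :=
    LinearMap.pi fun m => (comp ((m : ℕ) : ℤ) ∘ₗ (boundedOps q n).subtype).codRestrict _ fun φ => by
      have h := φ.2.1 m
      simp only at h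
      rwa [if_pos (by have := m.2; omega)] at h
  have hL : Function.Injective L := by
    refine fun φ ψ hφψ => Subtype.ext (comp_ext fun m => ?_)
    have h := φ.2.1 m
    have h' := ψ.2.1 m
    simp only at h h'
    split_ifs at h h' with hm
    · rcases lt_or_ge m 0 with h0 | h0
      · rw [expPolyLE_of_neg q h0, Submodule.mem_bot] at h h'
        rw [h, h']
      · lift m to ℕ using h0
        exact congrArg Subtype.val (congrFun hφψ ⟨m, by omega⟩)
    · exact ((Submodule.mem_bot K).mp h).trans ((Submodule.mem_bot K).mp h').symm
  refine ⟨FiniteDimensional.of_injective L hL, (LinearMap.finrank_le_finrank_of_injective hL).trans ?_⟩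
  rw [Module.finrank_pi_fintype]
  calc _ ≤ ∑ _m : Fin (n + 1), (n + 1) ^ 2 := Finset.sum_le_sum fun m _ =>
        (finrank_expPolyLE_le q m).trans (Nat.pow_le_pow_left (by have := m.2; omega) 2)
    _ = (n + 1) ^ 3 := by simp; ring

theorem one_sup_pow_mono {A : Type*} [Ring A] [Algebra K A] (V : Submodule K A) {a b : ℕ}
    (h : a ≤ b) : (1 ⊔ V) ^ a ≤ (1 ⊔ V) ^ b := by
  induction h with
  | refl => exact le_rfl
  | step _ ih =>
    rw [pow_succ, Submodule.mul_sup, mul_one]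
    exact ih.trans le_sup_left

theorem exists_mem_one_sup_genSpan_pow {q : K} {φ : Module.End K K[X]} (h : φ ∈ G q) :
    ∃ n, φ ∈ (1 ⊔ genSpan q) ^ n := by
  induction h using Algebra.adjoin_induction with
  | mem x hx => exact ⟨1, by rw [pow_one]; exact Submodule.mem_sup_right (Submodule.subset_span hx)⟩
  | algebraMap r => exact ⟨0, by rw [pow_zero]; exact Submodule.algebraMap_mem r⟩
  | add x y _ _ hx hy =>
    obtain ⟨a, ha⟩ := hx
    obtain ⟨b, hb⟩ := hy
    exact ⟨max a b, Submodule.add_mem _ (one_sup_pow_mono _ (le_max_left _ _) ha)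
      (one_sup_pow_mono _ (le_max_right _ _) hb)⟩
  | mul x y _ _ hx hy =>
    obtain ⟨a, ha⟩ := hx
    obtain ⟨b, hb⟩ := hy
    exact ⟨a + b, by rw [pow_add]; exact Submodule.mul_mem_mul ha hb⟩

theorem finrank_one_sup_pow_eq {q : K} (V : Submodule K (G q)) (n : ℕ) :
    Module.finrank K ↥((1 ⊔ V) ^ n) =
      Module.finrank K ↥((1 ⊔ V.map (G q).val.toLinearMap) ^ n) := by
  have h : ((1 ⊔ V) ^ n).map (G q).val.toLinearMap = (1 ⊔ V.map (G q).val.toLinearMap) ^ n := by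
    rw [Submodule.map_pow, Submodule.map_sup, Submodule.map_one]
  rw [← h]
  exact (LinearEquiv.finrank_eq (Submodule.equivMapOfInjective (G q).val.toLinearMap
    Subtype.val_injective _))

/-- The dimensions of the powers of a finite-dimensional subspace of `G` grow at most cubically. -/
theorem exists_finrank_one_sup_pow_le {q : K} (hq0 : q ≠ 0) (hq1 : q ≠ 1) {V : Submodule K (G q)}
    (hV : V.FG) : ∃ N : ℕ, ∀ n, Module.finrank K ↥((1 ⊔ V) ^ n) ≤ (N * n + 1) ^ 3 := by
  obtain ⟨s, rfl⟩ := hV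
  choose N hN using fun φ : G q => exists_mem_one_sup_genSpan_pow φ.2
  -- Each of the finitely many generators of `V` lies in some power of `1 ⊔ genSpan q`, and the
  -- largest exponent serves for all of them.
  refine ⟨s.sup N, fun n => ?_⟩
  have hle : 1 ⊔ (Submodule.span K (s : Set (G q))).map (G q).val.toLinearMap ≤
      (1 ⊔ genSpan q) ^ s.sup N := by
    refine sup_le ?_ (Submodule.map_le_iff_le_comap.mpr (Submodule.span_le.mpr fun φ hφ => ?_))
    · simpa using one_sup_pow_mono (genSpan q) (Nat.zero_le (s.sup N))
    · exact one_sup_pow_mono _ (Finset.le_sup hφ) (hN φ)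
  have hle' := (pow_le_pow_left' hle n).trans_eq (pow_mul (1 ⊔ genSpan q) (s.sup N) n).symm
  obtain ⟨hfin, hrank⟩ := finrank_boundedOps_le q (s.sup N * n)
  rw [finrank_one_sup_pow_eq]
  exact (Submodule.finrank_mono (hle'.trans (one_sup_genSpan_pow_le hq0 hq1 _))).trans hrank

/-- The witnesses are the `t ^ 3` independent monomials `∂₁ᶜ ∂₋₁ᵇ⁺¹ ∂ᵃ` with `a, b, c < t`. Their
length is at most `3 t - 2`. The exponent `b + 1` keeps the label in the single case `k < 0`. -/
theorem le_finrank_one_sup_genSpan_pow [CharZero K] (q : Kˣ)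
    (hq : Function.Injective fun k : ℤ => (q : K) ^ k) {t n : ℕ} (h : 3 * t ≤ n + 2) :
    t ^ 3 ≤ Module.finrank K ↥((1 ⊔ genSpan (q : K)) ^ n) := by
  have hq1 := ne_one_of_zpow_injective q hq
  let x : Fin t × Fin t × Fin t → {x : ℤ × ℕ × ℤ // IsIndex x.1 x.2} := fun y =>
    ⟨((y.1 + (y.2.1 + 1) + y.2.2 : ℕ), ((y.1 : ℕ), -((y.2.1 + 1 : ℕ) : ℤ))), by
      simp only [IsIndex]
      omega⟩
  have hx : Function.Injective x := by
    rintro ⟨a, b, c⟩ ⟨a', b', c'⟩ hxy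
    simp only [x, Subtype.mk.injEq, Prod.mk.injEq] at hxy
    simp only [Prod.mk.injEq, Fin.ext_iff]
    omega
  have hli := (linearIndependent_evalMon_word q hq hq1).comp x hx
  have hcard := finrank_span_eq_card hli
  obtain ⟨hfin, -⟩ := finrank_boundedOps_le (q : K) n
  have hfin' : FiniteDimensional K ↥((1 ⊔ genSpan (q : K)) ^ n) :=
    Submodule.finiteDimensional_of_le (one_sup_genSpan_pow_le q.ne_zero hq1 n)
  have ht : t ^ 3 = Fintype.card (Fin t × Fin t × Fin t) := by
    simp only [Fintype.card_prod, Fintype.card_fin]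
    ring
  rw [ht, ← hcard]
  refine Submodule.finrank_mono (Submodule.span_le.mpr ?_)
  rintro _ ⟨⟨a, b, c⟩, rfl⟩
  have hdel : ∀ {j : ℤ}, del (q : K) j ∈ ({del (q : K) 0, del (q : K) 1, del (q : K) (-1)} :
      Set (Module.End K K[X])) → ∀ e : ℕ, del (q : K) j ^ e ∈ (1 ⊔ genSpan (q : K)) ^ e :=
    fun hj e => Submodule.pow_mem_pow _ (Submodule.mem_sup_right (Submodule.subset_span hj)) e
  have hw : word (x (a, b, c)).1.1 (x (a, b, c)).1.2 =
      d₁w ^ (c : ℕ) * dₘ₁w ^ ((b : ℕ) + 1) * dw ^ (a : ℕ) := by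
    simp only [x, word, abs_neg, Nat.abs_cast, Int.natAbs_neg, Int.natAbs_natCast]
    rw [if_pos (by omega)]
    have h1 : ((a : ℕ) + (((b : ℕ) + 1 : ℕ) : ℤ) -
        (((a : ℕ) + ((b : ℕ) + 1) + (c : ℕ) : ℕ) : ℤ)).toNat = 0 := by omega
    have h2 : ((((a : ℕ) + ((b : ℕ) + 1) + (c : ℕ) : ℕ) : ℤ) - (a : ℕ) -
        (((b : ℕ) + 1 : ℕ) : ℤ)).toNat = c := by omega
    rw [h1, h2, pow_zero, one_mul]
  rw [Function.comp_apply, hw]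
  simp only [map_mul, map_pow, evalMon_dw, evalMon_d₁w, evalMon_dₘ₁w]
  refine one_sup_pow_mono _ (by omega : (c : ℕ) + ((b : ℕ) + 1) + (a : ℕ) ≤ n) ?_
  rw [pow_add, pow_add]
  exact Submodule.mul_mem_mul (Submodule.mul_mem_mul (hdel (by simp) _) (hdel (by simp) _))
    (hdel (by simp) _)

theorem tendsto_add_div_log (c : ℝ) :
    Filter.Tendsto (fun n : ℕ => (((3 * Real.log n + c) / Real.log n : ℝ) : EReal)) Filter.atTop
      (nhds 3) := by
  have h1 : Filter.Tendsto (fun n : ℕ => Real.log n) Filter.atTop Filter.atTop :=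
    Real.tendsto_log_atTop.comp tendsto_natCast_atTop_atTop
  have h2 : Filter.Tendsto (fun n : ℕ => 3 + c / Real.log n) Filter.atTop (nhds (3 + 0)) :=
    tendsto_const_nhds.add (tendsto_const_nhds.div_atTop h1)
  rw [add_zero] at h2
  refine (continuous_coe_real_ereal.tendsto (3 : ℝ)).comp (h2.congr' ?_)
  filter_upwards [h1.eventually_gt_atTop 0] with n hn
  field_simp

theorem gkDim_G [CharZero K] (q : Kˣ) (hq : Function.Injective fun k : ℤ => (q : K) ^ k) :
    gkDim K ↥(G (q : K)) = 3 := by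
  have hq1 := ne_one_of_zpow_injective q hq
  refine le_antisymm (iSup_le fun V => ?_) ?_
  · obtain ⟨N, hN⟩ := exists_finrank_one_sup_pow_le q.ne_zero hq1 V.2
    rw [← (tendsto_add_div_log (3 * Real.log (N + 1))).limsup_eq]
    refine Filter.limsup_le_limsup ?_
    filter_upwards [Filter.eventually_ge_atTop 2] with n hn
    have hn' : (2 : ℝ) ≤ n := by exact_mod_cast hn
    refine EReal.coe_le_coe_iff.mpr (div_le_div_of_nonneg_right ?_ (Real.log_nonneg (by linarith)))
    -- For rank zero the convention `Real.log 0 = 0` leaves only the nonnegativity of the right-hand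
    -- side.
    rcases Nat.eq_zero_or_pos (Module.finrank K ↥((1 ⊔ (V : Submodule K (G (q : K)))) ^ n))
      with h0 | h0
    · rw [h0, Nat.cast_zero, Real.log_zero]
      have := Real.log_nonneg (by linarith : (1 : ℝ) ≤ n)
      have := Real.log_nonneg (by linarith [Nat.cast_nonneg (α := ℝ) N] : (1 : ℝ) ≤ N + 1)
      positivity
    · have h1 : (Module.finrank K ↥((1 ⊔ (V : Submodule K (G (q : K)))) ^ n) : ℝ) ≤
          (n * (N + 1)) ^ 3 := by
        refine (Nat.cast_le.mpr (hN n)).trans ?_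
        push_cast
        refine pow_le_pow_left₀ (by positivity) ?_ 3
        linarith
      refine (Real.log_le_log (by exact_mod_cast h0) h1).trans_eq ?_
      rw [Real.log_pow, Real.log_mul (by linarith) (by positivity)]
      push_cast
      ring
  · have hle : genSpan (q : K) ≤ LinearMap.range (G (q : K)).val.toLinearMap := by
      refine Submodule.span_le.mpr fun φ hφ => ⟨⟨φ, Algebra.subset_adjoin hφ⟩, rfl⟩
    let V : Submodule K (G (q : K)) := (genSpan (q : K)).comap (G (q : K)).val.toLinearMap
    have hmap : V.map (G (q : K)).val.toLinearMap = genSpan (q : K) :=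
      Submodule.map_comap_eq_of_le hle
    have hVfg : V.FG := by
      refine Submodule.fg_of_fg_map_injective (G (q : K)).val.toLinearMap Subtype.val_injective ?_
      rw [hmap]
      exact Submodule.fg_span (by simp)
    refine le_trans ?_ (le_iSup _ (⟨V, hVfg⟩ : {V : Submodule K (G (q : K)) // V.FG}))
    rw [← (tendsto_add_div_log (-(3 * Real.log 3))).limsup_eq]
    refine Filter.limsup_le_limsup ?_
    filter_upwards [Filter.eventually_ge_atTop 2] with n hn
    have hn' : (2 : ℝ) ≤ n := by exact_mod_cast hn
    refine EReal.coe_le_coe_iff.mpr (div_le_div_of_nonneg_right ?_ (Real.log_nonneg (by linarith)))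
    rw [finrank_one_sup_pow_eq, hmap]
    -- Here `(n + 2) / 3` is `n / 3` rounded up, so that its cube is at least `(n / 3) ^ 3`.
    have h1 := le_finrank_one_sup_genSpan_pow q hq (t := (n + 2) / 3) (n := n) (by omega)
    have h2 : (n : ℝ) / 3 ≤ ((n + 2) / 3 : ℕ) := by
      rw [div_le_iff₀ (by norm_num)]
      exact_mod_cast (by omega : n ≤ (n + 2) / 3 * 3)
    have h3 : ((n : ℝ) / 3) ^ 3 ≤ Module.finrank K ↥((1 ⊔ genSpan (q : K)) ^ n) :=
      (pow_le_pow_left₀ (by positivity) h2 3).trans (by exact_mod_cast h1)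
    refine le_trans (le_of_eq ?_) (Real.log_le_log (by positivity) h3)
    rw [Real.log_pow, Real.log_div (by linarith) (by norm_num)]
    push_cast
    ring

end GKDimension

/-! ### Transcendence and the main theorem -/

theorem zpow_injective_of_transcendental {K : Type*} [Field K] [Algebra ℚ K] {q : K}
    (hq : Transcendental ℚ q) : Function.Injective fun k : ℤ => q ^ k := by
  have hq0 : q ≠ 0 := by
    rintro rfl
    exact hq isAlgebraic_zero
  have key : ∀ n : ℕ, q ^ (n + 1) ≠ 1 := fun n h =>
    hq (IsAlgebraic.of_pow n.succ_pos (h ▸ isAlgebraic_one))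
  have key' : ∀ a b : ℤ, a < b → q ^ a ≠ q ^ b := by
    intro a b hab h
    obtain ⟨n, rfl⟩ : ∃ n : ℕ, b = a + ((n + 1 : ℕ) : ℤ) := ⟨(b - a - 1).toNat, by omega⟩
    rw [zpow_add₀ hq0, zpow_natCast] at h
    exact key n (mul_left_cancel₀ (zpow_ne_zero a hq0) (by rw [mul_one]; exact h.symm))
  intro a b h
  rcases lt_trichotomy a b with hab | hab | hab
  · exact absurd h (key' a b hab)
  · exact hab
  · exact absurd h.symm (key' b a hab)

end QDiff

end

theorem mainTheorem5 {K : Type*} [Field K] [CharZero K] (q : K) (hq : Transcendental ℚ q) :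
    -- the dimensions of the graded components of `G`
    (∀ n : ℕ, 1 ≤ n → Module.rank K ↥(QDiff.Gcomp q n) = ((n ^ 2 + n + 1 : ℕ) : Cardinal)) ∧
    -- `𝒢` is a basis for `G`
    (LinearIndepOn K (fun w => QDiff.evalMon q w) QDiff.monG ∧
      Submodule.span K ((fun w => QDiff.evalMon q w) '' QDiff.monG) =
        Subalgebra.toSubmodule (QDiff.G q)) ∧
    -- the Hilbert series of `G` is `(1 + t ^ 2) / (1 - t) ^ 3`
    (PowerSeries.mk (fun n : ℕ => (Module.finrank K ↥(QDiff.Gcomp q n) : ℤ)) *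
        (1 - PowerSeries.X) ^ 3 = 1 + PowerSeries.X ^ 2) ∧
    -- the Gelfand–Kirillov dimension of `G` is 3
    QDiff.gkDim K ↥(QDiff.G q) = 3 ∧
    -- `𝒟` is a basis for `D = D_q(K[x])`
    (LinearIndepOn K (fun w => QDiff.evalMon q w) QDiff.monD ∧
      Submodule.span K ((fun w => QDiff.evalMon q w) '' QDiff.monD) = QDiff.DqPoly q) := by
  have hinj := QDiff.zpow_injective_of_transcendental hq
  have hq0 : q ≠ 0 := by
    rintro rfl
    exact hq isAlgebraic_zero
  lift q to Kˣ using hq0.isUnit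
  have hq1 := QDiff.ne_one_of_zpow_injective q hinj
  have hD := QDiff.linearIndepOn_monD q hq1 hinj
  refine ⟨fun n _ => QDiff.rank_Gcomp q hq1 hinj n, ⟨hD.mono fun w hw => Or.inl (Or.inl hw),
    QDiff.span_monG q hq1 hinj⟩, ?_, QDiff.gkDim_G q hinj, hD, QDiff.span_monD q hq1 hinj⟩
  simp only [QDiff.finrank_Gcomp q hq1 hinj]
  exact QDiff.hilbertSeries_eq
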